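/- Let $\Bbbk$ be an algebraically closed field, $n \ge 0$, and let $$1 \to G \xrightarrow{i} \Gamma \xrightarrow{\pi} \mathbb{G}_m^n \to 1$$ be an exact sequence of algebraic groups (group schemes of finite type) over $\Bbbk$, where $G$ is a finite group, regarded as a constant (equivalently, finite étale) group scheme over $\Bbbk$. Exactness of a sequence $1\to N\to H\to Q\to 1$ of group schemes means that $H\to Q$ is faithfully flat and quasi-compact with scheme-theoretic kernel $N$; then $Q$ is the quotient $H/N$. For $r=(r_1,\dots,r_n)$ write $\mu_r=\mu_{r_1}\times\cdots\times\mu_{r_n}$. Let $T=\Gamma^0\subset\Gamma$ be the identity component, i.e. the open subgroup scheme supported on the connected component of the identity. Then: 1. There is a tuple $r=(r_1,\dots,r_n)$ of positive integers with $r_1\mid r_2\mid\cdots\mid r_n$, an isomorphism $T\cong\mathbb{G}_m^n$ and an automorphism of the target $\mathbb{G}_m^n$ such that, under these identifications, the composite $T\hookrightarrow\Gamma\to\mathbb{G}_m^n$ is $(t_1,\dots,t_n)\mapsto(t_1^{r_1},\dots,t_n^{r_n})$, and the scheme-theoretic intersection $T\cap G\subset T$ is the standard subgroup $\mu_r\subset\mathbb{G}_m^n$.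 The tuple is unique: if $r'_1\mid\cdots\mid r'_n$ are non-negative integers and $T\cap G\cong\mu_{r'}$ as group schemes (with $\mu_0=\mathbb{G}_m$), then $r'=r$. 2. Identify $\mu_r$ with $T\cap G$. The quotients $\bar G=G/\mu_r$ and $\bar\Gamma=\Gamma/\mu_r$ exist, $i$ and $\pi$ induce an exact sequence $1\to\bar G\to\bar\Gamma\to\mathbb{G}_m^n\to1$, and this sequence is trivially split: there is an isomorphism $\bar\Gamma\cong\bar G\times\mathbb{G}_m^n$ of group schemes compatible with the inclusion of $\bar G$ and with the projection to $\mathbb{G}_m^n$. 3. The subgroup $T$ is central in $\Gamma$ (for every $\Bbbk$-scheme $S$, elements of $T(S)$ commute with elements of $\Gamma(S)$), and the isomorphism in part 2 can be chosen so that the composite $\Gamma\to\bar\Gamma\cong\bar G\times\mathbb{G}_m^n\to\bar G$ is the quotient of $\Gamma$ by $T$; in particular $\Gamma/T\cong\bar G=G/\mu_r$. -/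

import Mathlib

open CategoryTheory Limits AlgebraicGeometry MonoidalCategory CartesianMonoidalCategory
open scoped MonObj

universe u

/-- Group schemes over the field `k`. -/
abbrev GroupScheme (k : Type u) [Field k] :=
  Grp (Over (Spec (.of k)))

namespace GroupScheme

variable {k : Type u} [Field k]

/-- The morphism of `k`-schemes underlying a homomorphism of group schemes. -/
abbrev underlying {H K : GroupScheme k} (f : H ⟶ K) : H.X ⟶ K.X := f.hom.hom

/-- An algebraic group over `k`: a group scheme of finite type over `k`. -/
structure IsAlgebraic (H : GroupScheme k) : Prop where
  locallyOfFiniteType : LocallyOfFiniteType H.X.hom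
  quasiCompact : QuasiCompact H.X.hom

/-- A finite étale group scheme over `k`. When `k` is algebraically closed these are exactly the
constant group schemes attached to finite groups. -/
structure IsFiniteEtale (H : GroupScheme k) : Prop where
  finite : IsFinite H.X.hom
  etale : Etale H.X.hom

/-- `1 ⟶ N ⟶ H ⟶ Q ⟶ 1` is an exact sequence of group schemes: `q` is faithfully flat and
quasi-compact and `i` is the scheme-theoretic kernel of `q`. In particular `Q` is the quotient of
`H` by the normal subgroup `N`. -/
structure IsShortExact {N H Q : GroupScheme k} (i : N ⟶ H) (q : H ⟶ Q) : Prop where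
  isKernel : IsPullback (underlying i) (toUnit N.X) (underlying q) η[Q.X]
  flat : Flat (underlying q).left
  surjective : Surjective (underlying q).left
  quasiCompact : QuasiCompact (underlying q).left

/-- The identity element of `H`, as a point of the underlying topological space. -/
noncomputable def identityPoint (H : GroupScheme k) : H.X.left :=
  (η[H.X] : 𝟙_ (Over (Spec (.of k))) ⟶ H.X).left (IsLocalRing.closedPoint k)

/-- The homomorphism `j : T ⟶ H` is the inclusion of the identity component: an open subgroup
scheme whose underlying space is the connected component of the identity. -/
structure IsIdentityComponent {T H : GroupScheme k} (j : T ⟶ H) : Prop where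
  isOpenImmersion : IsOpenImmersion (underlying j).left
  range_eq : Set.range (underlying j).left = connectedComponent H.identityPoint

/-- The subgroup `j : T ⟶ H` is central: on points with values in any `k`-scheme `S`, elements
of `T(S)` commute with elements of `H(S)`. -/
def IsCentral {T H : GroupScheme k} (j : T ⟶ H) : Prop :=
  ∀ (S : Over (Spec (.of k))) (t : S ⟶ T.X) (h : S ⟶ H.X),
    (t ≫ underlying j) * h = h * (t ≫ underlying j)

variable (k)

/-- The diagonalizable group scheme `Spec k[M]` with character group `M`. -/
noncomputable def diagGroup (M : Type) [AddCommGroup M] : GroupScheme k :=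
  (hopfSpec (.of k)).obj (.op (.of k (AddMonoidAlgebra k M)))

/-- The homomorphism of diagonalizable group schemes dual to a homomorphism of character groups. -/
noncomputable def diagMap {M N : Type} [AddCommGroup M] [AddCommGroup N] (f : M →+ N) :
    diagGroup k N ⟶ diagGroup k M :=
  (hopfSpec (.of k)).map (Quiver.Hom.op
    (CommHopfAlgCat.ofHom (AddMonoidAlgebra.mapDomainBialgHom k f)))

/-- The standard split torus of rank `n`, with coordinate ring `k[t₁^±1, …, tₙ^±1] = k[ℤⁿ]`. -/
noncomputable abbrev Gm (n : ℕ) : GroupScheme k :=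
  diagGroup k (Fin n → ℤ)

/-- The group scheme `μ_{r₁} × ⋯ × μ_{rₙ}`, the diagonalizable group scheme with character group
`ℤ/r₁ × ⋯ × ℤ/rₙ`. -/
noncomputable abbrev mu {n : ℕ} (r : Fin n → ℕ) : GroupScheme k :=
  diagGroup k (∀ a, ZMod (r a))

/-- The standard inclusion of `μ_{r₁} × ⋯ × μ_{rₙ}` into the torus of rank `n`, dual to the
reduction map `ℤⁿ ⟶ ℤ/r₁ × ⋯ × ℤ/rₙ`. -/
noncomputable def muInclusion {n : ℕ} (r : Fin n → ℕ) : mu k r ⟶ Gm k n :=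
  diagMap k (AddMonoidHom.pi fun a =>
    (Int.castAddHom (ZMod (r a))).comp (Pi.evalAddMonoidHom (fun _ : Fin n => ℤ) a))

/-- The endomorphism `(t₁, …, tₙ) ↦ (t₁^r₁, …, tₙ^rₙ)` of the torus of rank `n`, dual to
`(m₁, …, mₙ) ↦ (r₁ m₁, …, rₙ mₙ)` on characters. -/
noncomputable def powerMap {n : ℕ} (r : Fin n → ℕ) : Gm k n ⟶ Gm k n :=
  diagMap k (AddMonoidHom.pi fun a =>
    (r a) • Pi.evalAddMonoidHom (fun _ : Fin n => ℤ) a)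

end GroupScheme

/-!
Let `T` be the identity component of `Γ`.

The homomorphism `π` is a `G`-torsor (`IsKernel.shear`), so it is finite étale by fpqc descent
(`IsShortExact.etale`, `IsShortExact.isFinite`). Being open and closed, it maps `T` onto the
connected torus; this also bounds the number of components of `Γ`. For a rational point `y` of `Γ`
the commutator morphism `t ↦ t y t⁻¹ y⁻¹` maps the connected scheme `T` to the discrete scheme `G`,
hence is trivial on rational points. As `T × Γ` is étale over a product of tori, it is reduced, and
equality on rational points is equality: `T` is central (`isCentral_identityComponent`).

Let `d` be the order of `G`. Two points of `T` with the same image in the torus differ by a point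
of `G`, which `d` kills, so the `d`-th power map of the commutative group `T` descends along
`T ⟶ Gmⁿ` to a homomorphism `s : Gmⁿ ⟶ T` (`exists_descent_pow`). The composite of `s` with
`T ⟶ Gmⁿ` is the `d`-th power map, which is surjective, and `T ⟶ Gmⁿ` has finite kernel; as `T` is
connected, `s` is surjective (`surjective_of_finite_kernel`). So the coordinate ring of `T` is a
Hopf subalgebra of `k[ℤⁿ]`, and such a subalgebra is spanned by the characters it contains
(`exists_bialgEquiv_of_injective`): `T` is diagonalizable, with a free character group of rank `n`.

By duality `T ⟶ Gmⁿ` is given by an injection of lattices of rank `n`, and the Smith normal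
form turns it into `(t₁, …, tₙ) ↦ (t₁^r₁, …, tₙ^rₙ)` (`exists_powerMap`). The intersection `T ∩ G`
is the kernel of `T ⟶ Gmⁿ`, that is `μ_r`. An isomorphism `μ_r ≅ μ_r'` is an isomorphism of
character groups, so `r` is unique by uniqueness of invariant factors (`eq_of_mu_iso`).

The group `E` of components of the group of rational points of `Γ`, regarded as a constant group
scheme, receives a homomorphism `q` from `Γ` with kernel `T`. The homomorphism
`(q, π) : Γ ⟶ E × Gmⁿ` is étale because `π` is, it is surjective because `T` already surjects onto
`Gmⁿ`, and its kernel is `T ∩ G`. Thus `E × Gmⁿ` is the quotient `Γ / (T ∩ G)`, while the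
restriction of `q` to `G` identifies `E` with `G / (T ∩ G)` (`exists_quotients`).
-/

namespace GroupScheme

/-! ### Rational points over an algebraically closed field -/

section RationalPoints

variable {k : Type u} [Field k]

/-- The point of the underlying space of `X` given by a `k`-rational point, the latter being a
morphism from the terminal object `𝟙_ _ = Spec k`. -/
noncomputable def pt {X : Over (Spec (.of k))} (x : 𝟙_ (Over (Spec (.of k))) ⟶ X) : X.left :=
  x.left (IsLocalRing.closedPoint k)

section Points

variable {X Y Z : Over (Spec (.of k))}

lemma pt_comp (x : 𝟙_ (Over (Spec (.of k))) ⟶ X) (f : X ⟶ Y) : pt (x ≫ f) = f.left (pt x) := rfl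

lemma pt_one (H : GroupScheme k) : pt (1 : 𝟙_ _ ⟶ H.X) = H.identityPoint := by
  simp [pt, identityPoint, MonObj.one_eq_one]

instance subsingleton_unit : Subsingleton (𝟙_ (Over (Spec (.of k)))).left :=
  inferInstanceAs (Subsingleton (Spec (.of k)))

lemma pt_eq_of_left (x : 𝟙_ (Over (Spec (.of k))) ⟶ X) (a : (𝟙_ (Over (Spec (.of k)))).left) :
    x.left a = pt x :=
  congrArg _ (Subsingleton.elim _ _)

lemma jacobsonSpace_left (X : Over (Spec (.of k))) [LocallyOfFiniteType X.hom] :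
    JacobsonSpace X.left :=
  LocallyOfFiniteType.jacobsonSpace X.hom

variable [IsAlgClosed k]

section
variable [LocallyOfFiniteType X.hom]

lemma isClosed_pt (x : 𝟙_ (Over (Spec (.of k))) ⟶ X) : IsClosed {pt x} :=
  (pointEquivClosedPoint X.hom ⟨x.left, Over.w x⟩).2

lemma exists_pt_eq {p : X.left} (hp : IsClosed {p}) : ∃ x : 𝟙_ _ ⟶ X, pt x = p :=
  ⟨Over.homMk (pointOfClosedPoint X.hom p hp) (by simp), pointOfClosedPoint_apply X.hom p hp _⟩

lemma pt_injective : Function.Injective (pt (X := X)) := fun x y h ↦ by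
  ext1
  exact ext_of_apply_closedPoint_eq X.hom (Over.w x) (Over.w y) h

/-- Every nonempty locally closed subset contains a rational point. -/
lemma exists_pt_mem {S : Set X.left} (hS : IsLocallyClosed S) (hS' : S.Nonempty) :
    ∃ x : 𝟙_ _ ⟶ X, pt x ∈ S := by
  have := jacobsonSpace_left X
  obtain ⟨p, hp, hc⟩ := nonempty_inter_closedPoints hS' hS
  obtain ⟨x, rfl⟩ := exists_pt_eq hc
  exact ⟨x, hp⟩

lemma eq_univ_of_isOpen {S : Set X.left} (hS : IsOpen S) (h : ∀ x : 𝟙_ _ ⟶ X, pt x ∈ S) :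
    S = Set.univ := by
  by_contra hne
  obtain ⟨x, hx⟩ := exists_pt_mem hS.isClosed_compl.isLocallyClosed (Set.nonempty_compl.mpr hne)
  exact hx (h x)

lemma eq_univ_of_isClosed {S : Set X.left} (hS : IsClosed S) (h : ∀ x : 𝟙_ _ ⟶ X, pt x ∈ S) :
    S = Set.univ := by
  by_contra hne
  obtain ⟨x, hx⟩ := exists_pt_mem hS.isOpen_compl.isLocallyClosed (Set.nonempty_compl.mpr hne)
  exact hx (h x)

end

/-- Morphisms from a reduced scheme to a separated scheme are determined by rational points. -/
lemma ext_pts [LocallyOfFiniteType X.hom] [LocallyOfFiniteType Y.hom] [IsReduced X.left]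
    [IsSeparated Y.hom] {f g : X ⟶ Y} (h : ∀ x : 𝟙_ _ ⟶ X, x ≫ f = x ≫ g) : f = g := by
  ext1
  have : LocallyOfFiniteType (f.left ≫ Y.hom) := by rw [Over.w]; infer_instance
  refine ext_of_apply_eq Y.hom Set.univ isOpen_univ.isLocallyClosed dense_univ (fun p _ hp ↦ ?_)
    (by simp)
  obtain ⟨x, rfl⟩ := exists_pt_eq hp
  rw [← pt_comp, ← pt_comp, h]

/-- A continuous map to a discrete space is determined by its values on rational points. -/
lemma continuous_ext_pts [LocallyOfFiniteType X.hom] {Q : Type*} [TopologicalSpace Q]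
    [DiscreteTopology Q] {f g : X.left → Q} (hf : Continuous f) (hg : Continuous g)
    (h : ∀ x : 𝟙_ _ ⟶ X, f (pt x) = g (pt x)) : f = g := by
  have := eq_univ_of_isClosed (isClosed_eq hf hg) h
  exact funext fun x ↦ (Set.eq_univ_iff_forall.mp this x)

end Points

/-- A group scheme over a field is separated: its diagonal is the preimage of the unit section
under `(x, y) ↦ x⁻¹ y`, and the unit section is a closed immersion. -/
instance isSeparated_hom (H : GroupScheme k) : IsSeparated H.X.hom := by
  -- the morphism `(x, y) ↦ x⁻¹ y`
  let δ : H.X ⊗ H.X ⟶ H.X := (fst _ _)⁻¹ * snd _ _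
  have h : IsPullback (lift (𝟙 H.X) (𝟙 H.X)) (toUnit H.X) δ η[H.X] := by
    refine ⟨⟨?_⟩, ⟨PullbackCone.IsLimit.mk _ (fun s ↦ s.fst ≫ fst _ _) ?_ ?_ ?_⟩⟩
    · simp [δ, MonObj.comp_mul, GrpObj.comp_inv, MonObj.one_eq_one]
    · intro s
      have := s.condition
      simp only [δ, MonObj.comp_mul, GrpObj.comp_inv, MonObj.one_eq_one, MonObj.comp_one] at this
      rw [inv_mul_eq_one] at this
      apply CartesianMonoidalCategory.hom_ext <;> simp [this]
    · intro s; exact toUnit_unique _ _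
    · intro s m h1 h2
      rw [← h1]; simp
  have h2 := h.map (Over.forget _)
  have h3 : IsClosedImmersion ((Over.forget _).map η[H.X]) :=
    inferInstanceAs (IsClosedImmersion η[H.X].left)
  refine ⟨?_⟩
  exact MorphismProperty.of_isPullback h2.flip h3

end RationalPoints

/-! ### Kernels and exact sequences -/

section ExactSequences

variable {k : Type u} [Field k]

/-- `i` is the scheme-theoretic kernel of `q`, expressed as the pullback of the unit section. -/
def IsKernel {N H Q : GroupScheme k} (i : N ⟶ H) (q : H ⟶ Q) : Prop :=
  IsPullback (underlying i) (toUnit N.X) (underlying q) η[Q.X]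

lemma comp_eta {S : Over (Spec (.of k))} (a : S ⟶ 𝟙_ _) (H : GroupScheme k) : a ≫ η[H.X] = 1 := by
  rw [MonObj.one_eq_one, MonObj.comp_one]

/-- A morphism of schemes that is multiplicative on points is a homomorphism. -/
lemma isMonHom_of_mul {A B : GroupScheme k} (f : A.X ⟶ B.X)
    (h : ∀ (S : Over (Spec (.of k))) (a b : S ⟶ A.X), (a * b) ≫ f = (a ≫ f) * (b ≫ f)) :
    IsMonHom f where
  one_hom := by
    have := h _ η[A.X] η[A.X]
    rw [MonObj.one_eq_one, mul_one, left_eq_mul] at this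
    rw [MonObj.one_eq_one, this, MonObj.one_eq_one]
  mul_hom := by
    have := h _ (fst A.X A.X) (snd A.X A.X)
    rw [MonObj.mul_eq_mul, this, Hom.mul_def]
    congr 1

namespace IsKernel

variable {N H Q : GroupScheme k} {i : N ⟶ H} {q : H ⟶ Q}

lemma comp_eq_one (h : IsKernel i q) : underlying i ≫ underlying q = 1 := by
  rw [h.w, MonObj.one_eq_one, MonObj.comp_one]

lemma mono (h : IsKernel i q) : Mono (underlying i) := by
  refine ⟨fun a b hab ↦ h.hom_ext hab (toUnit_unique _ _)⟩

lemma exists_lift (h : IsKernel i q) {S : Over (Spec (.of k))} (a : S ⟶ H.X)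
    (ha : a ≫ underlying q = 1) : ∃ g : S ⟶ N.X, g ≫ underlying i = a :=
  ⟨h.lift a (toUnit S) (by rw [ha, MonObj.one_eq_one, MonObj.comp_one]), h.lift_fst _ _ _⟩

lemma of_exists_lift [Mono (underlying i)] (h1 : underlying i ≫ underlying q = 1)
    (h2 : ∀ (S : Over (Spec (.of k))) (a : S ⟶ H.X), a ≫ underlying q = 1 →
      ∃ g : S ⟶ N.X, g ≫ underlying i = a) : IsKernel i q := by
  refine ⟨⟨?_⟩, ⟨PullbackCone.IsLimit.mk _
    (fun s ↦ (h2 _ s.fst (s.condition.trans (comp_eta _ _))).choose)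
    (fun s ↦ (h2 _ s.fst (s.condition.trans (comp_eta _ _))).choose_spec)
    (fun s ↦ toUnit_unique _ _) (fun s m h3 _ ↦ ?_)⟩⟩
  · rw [h1, MonObj.one_eq_one, MonObj.comp_one]
  · rw [← cancel_mono (underlying i), h3]
    exact (h2 _ s.fst (s.condition.trans (comp_eta _ _))).choose_spec.symm

/-- A homomorphism killed by `q` factors through the kernel of `q` as a homomorphism. -/
lemma exists_lift_hom (h : IsKernel i q) {A : GroupScheme k} (f : A ⟶ H)
    (hf : underlying f ≫ underlying q = 1) : ∃ g : A ⟶ N, g ≫ i = f := by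
  obtain ⟨g, hg⟩ := h.exists_lift _ hf
  have := h.mono
  have : IsMonHom g := isMonHom_of_mul g fun S a b ↦ by
    rw [← cancel_mono (underlying i), Category.assoc, hg, MonObj.mul_comp _ _ (underlying f),
      MonObj.mul_comp _ _ (underlying i), Category.assoc, Category.assoc, hg]
  exact ⟨Grp.homMk g, by ext; exact congr(($hg).left)⟩

end IsKernel

/-- The shear square: `H ×_Q H` is `H × N` via `(x, g) ↦ (x, x g)`. -/
lemma IsKernel.shear {N H Q : GroupScheme k} {i : N ⟶ H} {q : H ⟶ Q} (h : IsKernel i q) :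
    IsPullback (fst H.X N.X) (fst H.X N.X * (snd _ _ ≫ underlying i)) (underlying q)
      (underlying q) := by
  have hm := h.mono
  have key (s : PullbackCone (underlying q) (underlying q)) :
      ∃ g : s.pt ⟶ N.X, g ≫ underlying i = s.fst⁻¹ * s.snd := by
    refine h.exists_lift _ ?_
    rw [MonObj.mul_comp, GrpObj.inv_comp, inv_mul_eq_one]
    exact s.condition
  refine ⟨⟨?_⟩, ⟨PullbackCone.IsLimit.mk _ (fun s ↦ lift s.fst (key s).choose)
    (fun s ↦ lift_fst _ _) (fun s ↦ ?_) (fun s m h1 h2 ↦ ?_)⟩⟩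
  · rw [MonObj.mul_comp, Category.assoc, h.comp_eq_one, MonObj.comp_one, mul_one]
  · rw [MonObj.comp_mul, lift_fst, lift_snd_assoc, (key s).choose_spec, mul_inv_cancel_left]
  · apply CartesianMonoidalCategory.hom_ext
    · rw [lift_fst, h1]
    · rw [lift_snd, ← cancel_mono (underlying i), (key s).choose_spec, ← h1, ← h2,
        MonObj.comp_mul, inv_mul_cancel_left, Category.assoc]

lemma isReduced_of_etale_of_field {X : Scheme.{u}} {K : Type u} [Field K] (f : X ⟶ Spec (.of K))
    [Etale f] : IsReduced X := by
  have aff (R : CommRingCat.{u}) (g : Spec R ⟶ Spec (.of K)) (hg : Etale g) :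
      IsReduced (Spec R) := by
    obtain ⟨φ, rfl⟩ := Spec.map_surjective g
    rw [HasRingHomProperty.Spec_iff (P := @Etale)] at hg
    algebraize [φ.hom]
    have := Algebra.FormallyUnramified.isReduced_of_field K R
    infer_instance
  have comp {U V W : Scheme.{u}} (a : U ⟶ V) (b : V ⟶ W) (_ : IsOpenImmersion a) (_ : Etale b) :
      Etale (a ≫ b) := inferInstance
  apply +allowSynthFailures @IsReduced.of_openCover (𝒰 := X.affineCover)
  intro i
  have : IsOpenImmersion (X.affineCover.f i) := inferInstance
  exact aff _ (X.affineCover.f i ≫ f) (comp _ _ this ‹_›)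

lemma locallyQuasiFinite_of_etale {X Y : Scheme.{u}} (f : X ⟶ Y) [Etale f] :
    LocallyQuasiFinite f := by
  rw [HasRingHomProperty.iff_appLE (P := @LocallyQuasiFinite)]
  intro U V e
  have h := HasRingHomProperty.appLE @Etale f ‹_› U V e
  algebraize [(f.appLE U V e).hom]
  exact inferInstanceAs (Algebra.QuasiFinite _ _)

lemma geometricallyReduced_of_etale {X Y : Scheme.{u}} (f : X ⟶ Y) [Etale f] :
    GeometricallyReduced f := by
  refine ⟨fun K _ y Z fst snd h ↦ ?_⟩
  have : Etale snd := MorphismProperty.of_isPullback h ‹_›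
  exact isReduced_of_etale_of_field snd

lemma isReduced_of_etale {X Y : Scheme.{u}} (f : X ⟶ Y) [Etale f] [IsReduced Y]
    [IsLocallyNoetherian Y] : IsReduced X :=
  have := geometricallyReduced_of_etale f
  GeometricallyReduced.isReduced_of_flat_of_isLocallyNoetherian f

section ShortExact

variable {G Γ Q : GroupScheme k} {i : G ⟶ Γ} {π : Γ ⟶ Q}

lemma fpqc_of_isShortExact (hex : IsShortExact i π) :
    (@Surjective ⊓ @Flat ⊓ @QuasiCompact : MorphismProperty Scheme.{u}) (underlying π).left :=
  ⟨⟨hex.surjective, hex.flat⟩, hex.quasiCompact⟩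

/-- The shear square exhibits the projection `Γ × G ⟶ Γ` as the base change of `π` along itself, so
`π` inherits étaleness from `G` by fpqc descent. -/
lemma IsShortExact.etale (hex : IsShortExact i π) (hG : Etale G.X.hom) :
    Etale (underlying π).left := by
  have h := (IsKernel.shear (i := i) (q := π) hex.isKernel).map (Over.forget _)
  refine MorphismProperty.of_isPullback_of_descendsAlong h (fpqc_of_isShortExact hex) ?_
  exact inferInstanceAs (Etale (pullback.fst Γ.X.hom G.X.hom))

lemma IsShortExact.isFinite (hex : IsShortExact i π) (hG : Etale G.X.hom)
    (hG' : IsFinite G.X.hom) : IsFinite (underlying π).left := by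
  have h := (IsKernel.shear (i := i) (q := π) hex.isKernel).map (Over.forget _)
  have := hex.etale hG
  have := locallyQuasiFinite_of_etale (underlying π).left
  have h1 : UniversallyClosed (underlying π).left := by
    refine MorphismProperty.of_isPullback_of_descendsAlong h (fpqc_of_isShortExact hex) ?_
    exact inferInstanceAs (UniversallyClosed (pullback.fst Γ.X.hom G.X.hom))
  have h2 : IsSeparated ((underlying π).left ≫ Q.X.hom) := by
    rw [Over.w]; infer_instance
  have : IsSeparated (underlying π).left := .of_comp _ Q.X.hom
  have : IsProper (underlying π).left := {}
  exact IsFinite.of_isProper_of_locallyQuasiFinite _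

end ShortExact

end ExactSequences

/-! ### Geometry of diagonalizable group schemes -/

section DiagonalizableSchemes

variable (k : Type u) [Field k] (M : Type) [AddCommGroup M]

lemma diagMap_left {M N : Type} [AddCommGroup M] [AddCommGroup N] (f : M →+ N) :
    (underlying (diagMap k f)).left =
      Spec.map (CommRingCat.ofHom (AddMonoidAlgebra.mapDomainBialgHom k f :
        AddMonoidAlgebra k M →+* AddMonoidAlgebra k N)) := rfl

instance : IsAffine (diagGroup k M).X.left :=
  inferInstanceAs (IsAffine (Spec (.of (AddMonoidAlgebra k M))))

instance : IsCommMonObj (diagGroup k M).X :=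
  isCommMonObj_spec_asOver_spec (R := .of k) (A := .of (AddMonoidAlgebra k M))

instance [AddGroup.FG M] : LocallyOfFiniteType (diagGroup k M).X.hom := by
  have h : LocallyOfFiniteType
      (Spec.map (CommRingCat.ofHom (algebraMap k (AddMonoidAlgebra k M)))) := by
    rw [HasRingHomProperty.Spec_iff (P := @LocallyOfFiniteType)]
    simp only [CommRingCat.hom_ofHom, RingHom.finiteType_algebraMap]
    infer_instance
  exact h

instance [UniqueSums M] : IsIntegral (diagGroup k M).X.left :=
  have : IsDomain (CommRingCat.of (AddMonoidAlgebra k M)) :=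
    inferInstanceAs (IsDomain (AddMonoidAlgebra k M))
  inferInstanceAs (IsIntegral (Spec (.of (AddMonoidAlgebra k M))))

instance [AddGroup.FG M] : IsLocallyNoetherian (diagGroup k M).X.left := by
  have : IsNoetherianRing (AddMonoidAlgebra k M) := Algebra.FiniteType.isNoetherianRing k _
  exact inferInstanceAs (IsLocallyNoetherian (Spec (.of (AddMonoidAlgebra k M))))

instance [UniqueSums M] : GeometricallyReduced (diagGroup k M).X.hom := by
  refine ⟨fun K _ y Z fst snd h ↦ ?_⟩
  obtain ⟨φ, rfl⟩ := Spec.map_surjective y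
  algebraize [φ.hom]
  have e := isPullback_SpecMap_of_isPushout _ _ _ _
    (CommRingCat.isPushout_tensorProduct k (AddMonoidAlgebra k M) K)
  have e' : IsDomain (TensorProduct k (AddMonoidAlgebra k M) K) :=
    ((Algebra.TensorProduct.comm k (AddMonoidAlgebra k M) K).toRingEquiv.trans
      (AddMonoidAlgebra.scalarTensorEquiv k K (M := M)).toRingEquiv).toMulEquiv.isDomain
      (AddMonoidAlgebra K M)
  have : IsReduced (Spec (.of (TensorProduct k (AddMonoidAlgebra k M) K))) := inferInstance
  exact isReduced_of_isOpenImmersion (h.isoIsPullback _ _ e).hom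

variable {k}

lemma geometricallyReduced_of_etale_comp {X Y S : Scheme.{u}} (f : X ⟶ Y) (g : Y ⟶ S) [Etale f]
    [GeometricallyReduced g] [LocallyOfFiniteType g] : GeometricallyReduced (f ≫ g) := by
  refine ⟨fun K _ y Z a b h ↦ ?_⟩
  let c : Z ⟶ pullback g y := pullback.lift (a ≫ f) b (by simpa using h.w)
  have hc : IsPullback a c f (pullback.fst g y) := by
    refine IsPullback.of_right ?_ (pullback.lift_fst _ _ _)
      (IsPullback.of_hasPullback g y).flip |>.flip
    rw [show c ≫ pullback.snd g y = b from pullback.lift_snd _ _ _]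
    exact h.flip
  have : Etale c := MorphismProperty.of_isPullback hc ‹_›
  have : IsLocallyNoetherian (pullback g y) :=
    LocallyOfFiniteType.isLocallyNoetherian (pullback.snd g y)
  have : IsReduced (pullback g y) :=
    GeometricallyReduced.geometrically_isReduced _ _ _ (.of_hasPullback g y)
  exact isReduced_of_etale c

/-- Schemes étale over a torus have reduced products. -/
lemma isReduced_tensor_of_etale {n : ℕ} {X Y : Over (Spec (.of k))} (f : X ⟶ (Gm k n).X)
    (g : Y ⟶ (Gm k n).X) [Etale f.left] [Etale g.left] : IsReduced (X ⊗ Y).left := by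
  have : IsReduced X.left := isReduced_of_etale f.left
  have : GeometricallyReduced Y.hom := by
    rw [← Over.w g]
    exact geometricallyReduced_of_etale_comp _ _
  have : LocallyOfFiniteType X.hom := by
    rw [← Over.w f]; infer_instance
  have : IsLocallyNoetherian X.left := LocallyOfFiniteType.isLocallyNoetherian X.hom
  exact inferInstanceAs (IsReduced (pullback X.hom Y.hom))

instance locallyOfFiniteType_tensor (X Y : Over (Spec (.of k))) [LocallyOfFiniteType X.hom]
    [LocallyOfFiniteType Y.hom] : LocallyOfFiniteType (X ⊗ Y).hom :=
  inferInstanceAs (LocallyOfFiniteType (pullback.fst X.hom Y.hom ≫ X.hom))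

lemma IsFiniteEtale.isReduced {G : GroupScheme k} (hG : IsFiniteEtale G) : IsReduced G.X.left :=
  have := hG.etale
  isReduced_of_etale_of_field G.X.hom

end DiagonalizableSchemes

/-! ### Open subgroup schemes -/

section OpenSubgroups

variable {k : Type u} [Field k]

/-- A monomorphism into a group scheme through which the unit, the multiplication and the inversion
factor makes its source a subgroup scheme. -/
lemma exists_subgroup_of_mono {H : GroupScheme k} {X : Over (Spec (.of k))} (ω : X ⟶ H.X) [Mono ω]
    {e : 𝟙_ _ ⟶ X} (he : e ≫ ω = 1) {m : X ⊗ X ⟶ X}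
    (hm : m ≫ ω = (fst X X ≫ ω) * (snd X X ≫ ω)) {v : X ⟶ X} (hv : v ≫ ω = ω⁻¹) :
    ∃ (T : GroupScheme k) (j : T ⟶ H) (e : T.X ≅ X), underlying j = e.hom ≫ ω := by
  have hm' {S : Over (Spec (.of k))} (a b : S ⟶ X) :
      (lift a b ≫ m) ≫ ω = (a ≫ ω) * (b ≫ ω) := by
    rw [Category.assoc, hm, MonObj.comp_mul, lift_fst_assoc, lift_snd_assoc]
  let _ : GrpObj X :=
    { one := e
      mul := m
      one_mul := by
        have : e ▷ X = lift (toUnit _ ≫ e) (snd _ _) := by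
          apply CartesianMonoidalCategory.hom_ext
          · rw [whiskerRight_fst, lift_fst]; congr 1
          · simp
        rw [← cancel_mono ω, this, hm', Category.assoc, he, MonObj.comp_one, one_mul,
          leftUnitor_hom]
      mul_one := by
        have : X ◁ e = lift (fst _ _) (toUnit _ ≫ e) := by
          apply CartesianMonoidalCategory.hom_ext
          · simp
          · rw [whiskerLeft_snd, lift_snd]
            congr 1
            exact toUnit_unique _ _
        rw [← cancel_mono ω, this, hm', Category.assoc, he, MonObj.comp_one, mul_one,
          rightUnitor_hom]
      mul_assoc := by
        have h1 : m ▷ X ≫ m =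
            lift (lift (fst _ _ ≫ fst _ _) (fst _ _ ≫ snd _ _) ≫ m) (snd _ _) ≫ m := by
          congr 1
          apply CartesianMonoidalCategory.hom_ext
          · rw [lift_fst, whiskerRight_fst]
            congr 1
            apply CartesianMonoidalCategory.hom_ext <;> simp
          · simp
        have h2 : (α_ X X X).hom ≫ X ◁ m ≫ m =
            lift (fst _ _ ≫ fst _ _) (lift (fst _ _ ≫ snd _ _) (snd _ _) ≫ m) ≫ m := by
          rw [← Category.assoc]
          congr 1
          apply CartesianMonoidalCategory.hom_ext
          · simp
          · rw [lift_snd, Category.assoc, whiskerLeft_snd, ← Category.assoc]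
            congr 1
            apply CartesianMonoidalCategory.hom_ext <;> simp
        rw [← cancel_mono ω, h1, h2, hm', hm', hm', hm', mul_assoc]
      inv := v
      left_inv := by
        rw [← cancel_mono ω, hm', hv, Category.id_comp, Category.assoc, he, MonObj.comp_one,
          inv_mul_cancel]
      right_inv := by
        rw [← cancel_mono ω, hm', hv, Category.id_comp, Category.assoc, he, MonObj.comp_one,
          mul_inv_cancel] }
  let T : GroupScheme k := Grp.mk X
  have : IsMonHom (M := T.X) ω := isMonHom_of_mul (A := T) ω fun S a b ↦ by
    exact hm' a b
  exact ⟨T, Grp.homMk (A := T) ω, Iso.refl X, (Category.id_comp ω).symm⟩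

variable [IsAlgClosed k]

/-- An open subset whose rational points form a subgroup is an open subgroup scheme. -/
lemma exists_open_subgroup (H : GroupScheme k) [LocallyOfFiniteType H.X.hom] (U : H.X.left.Opens)
    (h1 : pt (1 : 𝟙_ _ ⟶ H.X) ∈ U)
    (hm : ∀ x y : 𝟙_ _ ⟶ H.X, pt x ∈ U → pt y ∈ U → pt (x * y) ∈ U)
    (hv : ∀ x : 𝟙_ _ ⟶ H.X, pt x ∈ U → pt x⁻¹ ∈ U) :
    ∃ (T : GroupScheme k) (j : T ⟶ H), IsOpenImmersion (underlying j).left ∧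
      Set.range (underlying j).left = U := by
  let X : Over (Spec (.of k)) := Over.mk (U.ι ≫ H.X.hom)
  let ω : X ⟶ H.X := Over.homMk U.ι
  have : IsOpenImmersion ω.left := inferInstanceAs (IsOpenImmersion U.ι)
  have : Mono ω := Over.mono_of_mono_left ω
  have hX : LocallyOfFiniteType X.hom := inferInstanceAs (LocallyOfFiniteType (U.ι ≫ H.X.hom))
  have hr : Set.range ω.left = U := U.range_ι
  have hpt (x : 𝟙_ _ ⟶ X) : pt (x ≫ ω) ∈ U := by
    rw [pt_comp, ← SetLike.mem_coe, ← hr]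
    exact ⟨_, rfl⟩
  have key {S : Over (Spec (.of k))} (hS : LocallyOfFiniteType S.hom) (f : S ⟶ H.X)
      (hf : ∀ x : 𝟙_ _ ⟶ S, pt (x ≫ f) ∈ U) : ∃ g : S ⟶ X, g ≫ ω = f := by
    have := eq_univ_of_isOpen (S := f.left ⁻¹' U) (U.2.preimage f.left.continuous) hf
    have hsub : Set.range f.left ⊆ Set.range ω.left := by
      rw [hr, ← Set.preimage_eq_univ_iff]; exact this
    refine ⟨Over.homMk (IsOpenImmersion.lift ω.left f.left hsub) ?_, ?_⟩
    · rw [← Over.w ω, IsOpenImmersion.lift_fac_assoc, Over.w]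
    · ext1; exact IsOpenImmersion.lift_fac _ _ _
  obtain ⟨e, he⟩ := key (S := 𝟙_ _) (inferInstanceAs (LocallyOfFiniteType (𝟙 _))) 1
    (fun x ↦ by rwa [MonObj.comp_one])
  obtain ⟨m, hm⟩ := key (S := X ⊗ X) inferInstance ((fst X X ≫ ω) * (snd X X ≫ ω)) (fun x ↦ by
    rw [MonObj.comp_mul, ← Category.assoc, ← Category.assoc]
    exact hm _ _ (hpt _) (hpt _))
  obtain ⟨v, hv⟩ := key (S := X) inferInstance ω⁻¹ (fun x ↦ by
    rw [GrpObj.comp_inv]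
    exact hv _ (hpt _))
  obtain ⟨T, j, e, hj⟩ := exists_subgroup_of_mono ω he hm hv
  have hj' : (underlying j).left = e.hom.left ≫ ω.left := by rw [hj]; simp
  have : IsIso e.hom.left := inferInstanceAs (IsIso ((Over.forget _).map e.hom))
  refine ⟨T, j, by rw [hj']; infer_instance, ?_⟩
  rw [hj', ← hr, Scheme.Hom.comp_base, TopCat.coe_comp,
    Set.range_comp, e.hom.left.surjective.range_eq, Set.image_univ]

end OpenSubgroups

/-! ### The identity component and its centrality -/

section IdentityComponent

lemma isOpen_connectedComponent_of_finite {X : Type*} [TopologicalSpace X]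
    [Finite (_root_.ConnectedComponents X)] (x : X) : IsOpen (connectedComponent x) := by
  rw [← connectedComponents_preimage_singleton]
  exact (isOpen_discrete _).preimage ConnectedComponents.continuous_coe

variable {k : Type u} [Field k]

lemma discreteTopology_of_isFiniteEtale {G : GroupScheme k} (hG : IsFiniteEtale G) :
    DiscreteTopology G.X.left := by
  have := hG.finite
  have h := G.X.hom.isDiscrete_preimage_singleton (IsLocalRing.closedPoint k)
  have h2 : G.X.hom ⁻¹' {IsLocalRing.closedPoint k} = Set.univ :=
    Set.eq_univ_of_forall fun x ↦ Subsingleton.elim (α := Spec (.of k)) _ _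
  exact isDiscrete_univ_iff.mp (Eq.mp (congrArg _root_.IsDiscrete h2) h)

/-- The component of the identity is stable under multiplication of rational points: right
translation by `y` maps it into a connected subset containing `y`. -/
lemma mul_mem_connectedComponent {H : GroupScheme k} (x y : 𝟙_ _ ⟶ H.X)
    (hx : pt x ∈ connectedComponent H.identityPoint)
    (hy : pt y ∈ connectedComponent H.identityPoint) :
    pt (x * y) ∈ connectedComponent H.identityPoint := by
  let r : H.X ⟶ H.X := 𝟙 H.X * (toUnit H.X ≫ y)
  have hr (z : 𝟙_ _ ⟶ H.X) : z ≫ r = z * y := by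
    simp [r, MonObj.comp_mul]
  have h := (isPreconnected_connectedComponent (x := H.identityPoint)).image r.left
    r.left.continuous.continuousOn
  have h1 : pt y ∈ r.left '' connectedComponent H.identityPoint :=
    ⟨pt 1, by rw [pt_one]; exact mem_connectedComponent, by rw [← pt_comp, hr, one_mul]⟩
  have := h.subset_connectedComponent h1
  rw [connectedComponent_eq hy]
  exact this ⟨pt x, hx, by rw [← pt_comp, hr]⟩

lemma inv_mem_connectedComponent {H : GroupScheme k} (x : 𝟙_ _ ⟶ H.X)
    (hx : pt x ∈ connectedComponent H.identityPoint) :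
    pt x⁻¹ ∈ connectedComponent H.identityPoint := by
  let r : H.X ⟶ H.X := (𝟙 H.X)⁻¹
  have hr (z : 𝟙_ _ ⟶ H.X) : z ≫ r = z⁻¹ := by
    simp [r, GrpObj.comp_inv]
  have h := (isPreconnected_connectedComponent (x := H.identityPoint)).image r.left
    r.left.continuous.continuousOn
  have h1 : H.identityPoint ∈ r.left '' connectedComponent H.identityPoint :=
    ⟨pt 1, by rw [pt_one]; exact mem_connectedComponent, by rw [← pt_comp, hr, inv_one, pt_one]⟩
  exact h.subset_connectedComponent h1 ⟨pt x, hx, by rw [← pt_comp, hr]⟩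

lemma exists_identityComponent [IsAlgClosed k] (H : GroupScheme k) [LocallyOfFiniteType H.X.hom]
    [Finite (_root_.ConnectedComponents H.X.left)] :
    ∃ (T : GroupScheme k) (j : T ⟶ H), IsIdentityComponent j := by
  obtain ⟨T, j, hj, hj'⟩ := exists_open_subgroup H
    ⟨connectedComponent H.identityPoint, isOpen_connectedComponent_of_finite _⟩
    (by rw [pt_one]; exact mem_connectedComponent) mul_mem_connectedComponent
    inv_mem_connectedComponent
  exact ⟨T, j, hj, hj'⟩

lemma IsIdentityComponent.preconnectedSpace {T H : GroupScheme k} {j : T ⟶ H}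
    (hj : IsIdentityComponent j) : PreconnectedSpace T.X.left := by
  have := hj.isOpenImmersion
  refine ⟨?_⟩
  rw [← (underlying j).left.isOpenEmbedding.isInducing.isPreconnected_image, Set.image_univ,
    hj.range_eq]
  exact isPreconnected_connectedComponent

section Extension

variable {n : ℕ} {G Γ : GroupScheme k} {i : G ⟶ Γ} {π : Γ ⟶ Gm k n}

/-- Each component of `Γ` meets every fibre of the finite étale map `π`, so there are finitely
many. -/
lemma finite_connectedComponents (hG : IsFiniteEtale G) (hex : IsShortExact i π) :
    Finite (_root_.ConnectedComponents Γ.X.left) := by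
  have := hex.isFinite hG.etale hG.finite
  have := hex.etale hG.etale
  obtain ⟨y⟩ : Nonempty (Gm k n).X.left := inferInstance
  exact IsOpenMap.finite_connectedComponents_of_finite_preimage_singleton_of_connectedSpace
    (underlying π).left.isOpenMap (underlying π).left.isClosedMap
    ((underlying π).left.finite_preimage_singleton y)

variable {T : GroupScheme k} {j : T ⟶ Γ}

/-- The identity component of the extension surjects onto the torus. -/
lemma surjective_identityComponent (hG : IsFiniteEtale G) (hex : IsShortExact i π)
    (hj : IsIdentityComponent j) : Surjective (underlying (j ≫ π)).left := by
  have := hex.isFinite hG.etale hG.finite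
  have := hex.etale hG.etale
  have := finite_connectedComponents hG hex
  refine ⟨?_⟩
  have h1 : (underlying (j ≫ π)).left = (underlying j).left ≫ (underlying π).left := by simp
  rw [← Set.range_eq_univ, h1, Scheme.Hom.comp_base, TopCat.coe_comp, Set.range_comp, hj.range_eq]
  refine IsClopen.eq_univ ⟨?_, ?_⟩ ?_
  · exact (underlying π).left.isClosedMap _ isClosed_connectedComponent
  · exact (underlying π).left.isOpenMap _ (isOpen_connectedComponent_of_finite _)
  · exact ⟨_, _, mem_connectedComponent, rfl⟩

variable [IsAlgClosed k]

/-- A morphism from the identity component to the extension with trivial image in the torus is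
constant on rational points, because `G` is discrete. -/
lemma comp_eq_one_of_comp_eq_one (hG : IsFiniteEtale G) (hex : IsShortExact i π)
    (hj : IsIdentityComponent j) {f : T.X ⟶ Γ.X} (hf : f ≫ underlying π = 1)
    (h1 : (1 : 𝟙_ _ ⟶ T.X) ≫ f = 1) (x : 𝟙_ _ ⟶ T.X) : x ≫ f = 1 := by
  have := discreteTopology_of_isFiniteEtale hG
  have := hj.preconnectedSpace
  have := hG.finite
  obtain ⟨g, rfl⟩ := IsKernel.exists_lift (i := i) (q := π) hex.isKernel f hf
  have hc : g.left (pt x) = g.left (pt 1) := PreconnectedSpace.constant ‹_› g.left.continuous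
  rw [← pt_comp, ← pt_comp] at hc
  rw [← Category.assoc, pt_injective hc, Category.assoc, h1]

/-- The identity component is central: commutators of its points with points of `Γ` lie in the
discrete group `G`, so they are trivial on rational points, and `T × Γ` is reduced. -/
lemma isCentral_identityComponent (hG : IsFiniteEtale G) [LocallyOfFiniteType Γ.X.hom]
    (hex : IsShortExact i π) (hj : IsIdentityComponent j) : IsCentral j := by
  have := hex.etale hG.etale
  have := hj.isOpenImmersion
  have hT : LocallyOfFiniteType T.X.hom := by rw [← Over.w (underlying j)]; infer_instance
  have key (x : 𝟙_ _ ⟶ T.X) (y : 𝟙_ _ ⟶ Γ.X) :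
      (x ≫ underlying j) * y = y * (x ≫ underlying j) := by
    -- the commutator with `y`, as a morphism of schemes
    let c : T.X ⟶ Γ.X := underlying j * (toUnit _ ≫ y) * (underlying j)⁻¹ * (toUnit _ ≫ y)⁻¹
    have hc (S : Over (Spec (.of k))) (s : S ⟶ T.X) : s ≫ c =
        (s ≫ underlying j) * (toUnit _ ≫ y) * (s ≫ underlying j)⁻¹ * (toUnit _ ≫ y)⁻¹ := by
      simp only [c, MonObj.comp_mul, GrpObj.comp_inv, ← Category.assoc]
      congr 4 <;> exact toUnit_unique _ _
    have h1 : c ≫ underlying π = 1 := by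
      simp only [c, MonObj.mul_comp, GrpObj.inv_comp]
      rw [mul_right_comm _ _ (_)⁻¹, mul_inv_cancel_right, mul_inv_cancel]
    have h2 := comp_eq_one_of_comp_eq_one hG hex hj h1
      (by rw [hc, MonObj.one_comp]; simp) x
    rw [hc, mul_inv_eq_one, mul_inv_eq_iff_eq_mul] at h2
    simpa using h2
  intro S t h
  have : IsReduced (T.X ⊗ Γ.X).left := by
    have : Etale (underlying (j ≫ π)).left := by
      have h1 : (underlying (j ≫ π)).left = (underlying j).left ≫ (underlying π).left := by simp
      rw [h1]; infer_instance
    exact isReduced_tensor_of_etale (underlying (j ≫ π)) (underlying π)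
  -- the universal case `S = T × Γ`
  have huniv : (fst T.X Γ.X ≫ underlying j) * snd T.X Γ.X =
      snd T.X Γ.X * (fst T.X Γ.X ≫ underlying j) := by
    refine ext_pts fun x ↦ ?_
    rw [MonObj.comp_mul, MonObj.comp_mul, ← Category.assoc]
    exact key _ _
  have := congr(lift t h ≫ $huniv)
  simpa [MonObj.comp_mul] using this

end Extension

end IdentityComponent

/-! ### Descent of power maps -/

section PowerMaps

variable {k : Type u} [Field k]

lemma comp_pow' {H : GroupScheme k} {S X : Over (Spec (.of k))} (a : S ⟶ X) (b : X ⟶ H.X) (d : ℕ) :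
    a ≫ (b ^ d) = (a ≫ b) ^ d := by
  induction d with
  | zero => simp
  | succ d ih => rw [pow_succ, pow_succ, MonObj.comp_mul, ih]

lemma pow_comp' {H K : GroupScheme k} {S : Over (Spec (.of k))} (a : S ⟶ H.X) (f : H ⟶ K) (d : ℕ) :
    (a ^ d) ≫ underlying f = (a ≫ underlying f) ^ d := by
  induction d with
  | zero => simp
  | succ d ih => rw [pow_succ, pow_succ, MonObj.mul_comp, ih]

lemma tensorHom_left_property (P : MorphismProperty Scheme.{u}) [P.IsStableUnderBaseChange]
    [P.IsStableUnderComposition] {X Y X' Y' : Over (Spec (.of k))} (f : X ⟶ X') (g : Y ⟶ Y')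
    (hf : P f.left) (hg : P g.left) : P (f ⊗ₘ g).left := by
  rw [Over.tensorHom_left]
  exact MorphismProperty.pullbackMap hf hg (Over.w f).symm (Over.w g).symm

lemma isCommMonObj_of_isCentral {T H : GroupScheme k} {j : T ⟶ H} [Mono (underlying j)]
    (h : IsCentral j) : IsCommMonObj T.X where
  mul_comm := by
    have := h _ (fst T.X T.X) (snd T.X T.X ≫ underlying j)
    rw [← MonObj.mul_comp, ← MonObj.mul_comp, cancel_mono, Hom.mul_def, Hom.mul_def] at this
    have e1 : lift (fst T.X T.X) (snd T.X T.X) = 𝟙 _ := by simp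
    have e2 : lift (snd T.X T.X) (fst T.X T.X) = (β_ T.X T.X).hom := by
      apply CartesianMonoidalCategory.hom_ext <;> simp
    rw [e1, e2, Category.id_comp] at this
    exact this.symm

section

variable {T H Q N : GroupScheme k} {i : N ⟶ H} {π : H ⟶ Q} {j : T ⟶ H}

/-- If `d` kills the kernel of `π` and `T` is central, raising to the power `d` on `T` only depends
on the image under `π`. -/
lemma pow_eq_pow_of_comp_eq [Mono (underlying j)] (hc : IsCentral j) (hk : IsKernel i π) {d : ℕ}
    (hd : ∀ (S : Over (Spec (.of k))) (g : S ⟶ N.X), g ^ d = 1) {S : Over (Spec (.of k))}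
    (a b : S ⟶ T.X) (hab : a ≫ underlying (j ≫ π) = b ≫ underlying (j ≫ π)) : a ^ d = b ^ d := by
  have e : underlying (j ≫ π) = underlying j ≫ underlying π := rfl
  have := isCommMonObj_of_isCentral hc
  obtain ⟨g, hg⟩ := hk.exists_lift ((a * b⁻¹) ≫ underlying j) (by
    rw [Category.assoc, ← e, MonObj.mul_comp, GrpObj.inv_comp, hab, mul_inv_cancel])
  have h1 : (a * b⁻¹) ^ d = 1 := by
    rw [← cancel_mono (underlying j), pow_comp', ← hg, ← pow_comp', hd, MonObj.one_comp,
      MonObj.one_comp]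
  rwa [mul_pow, inv_pow, mul_inv_eq_one] at h1

/-- Descent of the `d`-th power map on `T` along the fpqc homomorphism `T ⟶ Q`. Faithfully flat
quasi-compact morphisms are effective epimorphisms of schemes, which gives the morphism `s`; it is
a homomorphism because `T × T ⟶ Q × Q` is an epimorphism. -/
lemma exists_descent_pow [Mono (underlying j)] (hc : IsCentral j) (hk : IsKernel i π) {d : ℕ}
    (hd : ∀ (S : Over (Spec (.of k))) (g : S ⟶ N.X), g ^ d = 1)
    (hp : (@Surjective ⊓ @Flat ⊓ @QuasiCompact : MorphismProperty Scheme.{u})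
      (underlying (j ≫ π)).left) :
    ∃ s : Q ⟶ T, underlying (j ≫ π) ≫ underlying s = 𝟙 T.X ^ d ∧
      underlying s ≫ underlying (j ≫ π) = 𝟙 Q.X ^ d := by
  obtain ⟨⟨h1, h2⟩, h3⟩ := hp
  set p := underlying (j ≫ π) with hpdef
  have := isCommMonObj_of_isCentral hc
  have hdesc : ∀ {Z : Scheme.{u}} (g₁ g₂ : Z ⟶ T.X.left), g₁ ≫ p.left = g₂ ≫ p.left →
      g₁ ≫ (𝟙 T.X ^ d : T.X ⟶ T.X).left = g₂ ≫ (𝟙 T.X ^ d : T.X ⟶ T.X).left := by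
    intro Z g₁ g₂ h
    let S : Over (Spec (.of k)) := Over.mk (g₁ ≫ T.X.hom)
    let a : S ⟶ T.X := Over.homMk g₁
    let b : S ⟶ T.X := Over.homMk g₂ (by
      change g₂ ≫ T.X.hom = g₁ ≫ T.X.hom
      rw [← Over.w p, reassoc_of% h])
    have hab : a ≫ p = b ≫ p := by ext1; exact h
    have := pow_eq_pow_of_comp_eq hc hk hd a b hab
    have e : a ≫ (𝟙 T.X ^ d) = b ≫ (𝟙 T.X ^ d) := by simpa [comp_pow'] using this
    exact congr(($e).left)
  let s : Q.X ⟶ T.X := Over.homMk (EffectiveEpi.desc p.left (𝟙 T.X ^ d : T.X ⟶ T.X).left hdesc) (by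
    rw [← cancel_epi p.left, EffectiveEpi.fac_assoc, Over.w, Over.w])
  have hs : p ≫ s = 𝟙 T.X ^ d := by ext1; exact EffectiveEpi.fac _ _ hdesc
  have hepi : Epi (p ⊗ₘ p) := by
    have : MorphismProperty.IsStableUnderComposition (@Surjective : MorphismProperty Scheme.{u}) :=
      ⟨fun f g (_ : Surjective f) (_ : Surjective g) ↦ inferInstanceAs (Surjective (f ≫ g))⟩
    have e1 := tensorHom_left_property (@Surjective : MorphismProperty Scheme.{u}) p p h1 h1
    have e2 := tensorHom_left_property (@Flat : MorphismProperty Scheme.{u}) p p h2 h2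
    have e3 := tensorHom_left_property (@QuasiCompact : MorphismProperty Scheme.{u}) p p h3 h3
    exact Over.epi_of_epi_left _
  have hepi' : Epi p := Over.epi_of_epi_left _
  have hpow {S : Over (Spec (.of k))} (a : S ⟶ T.X) : (a ≫ p) ≫ s = a ^ d := by
    rw [Category.assoc, hs, comp_pow', Category.comp_id]
  have hmon : IsMonHom s := by
    refine isMonHom_of_mul s fun S a b ↦ ?_
    have : (fst Q.X Q.X * snd Q.X Q.X) ≫ s = (fst Q.X Q.X ≫ s) * (snd Q.X Q.X ≫ s) := by
      rw [← cancel_epi (p ⊗ₘ p), MonObj.comp_mul, ← Category.assoc, MonObj.comp_mul]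
      simp only [tensorHom_fst, tensorHom_snd, tensorHom_fst_assoc, tensorHom_snd_assoc]
      rw [← MonObj.mul_comp, hpow, mul_pow, ← hpow, ← hpow, Category.assoc, Category.assoc]
    have := congr(lift a b ≫ $this)
    rwa [← Category.assoc, MonObj.comp_mul, MonObj.comp_mul, lift_fst, lift_snd, lift_fst_assoc,
      lift_snd_assoc] at this
  refine ⟨Grp.homMk s, hs, ?_⟩
  change s ≫ p = _
  rw [← cancel_epi p, ← Category.assoc, hs, pow_comp', comp_pow', Category.comp_id,
    Category.id_comp]

end

end PowerMaps

/-! ### Power maps and Hopf subalgebras of group algebras -/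

section HopfSubalgebras

section Diagonalizable

variable {k : Type u} [Field k]

/-- The group law on homomorphisms into a diagonalizable group is addition on characters. -/
lemma diagMap_add {M N : Type} [AddCommGroup M] [AddCommGroup N] (f g : M →+ N) :
    underlying (diagMap k (f + g)) = underlying (diagMap k f) * underlying (diagMap k g) := by
  have key : (WithConv.toConv (AddMonoidAlgebra.mapDomainBialgHom k (f + g) :
      AddMonoidAlgebra k M →ₐ[k] AddMonoidAlgebra k N)) =
      WithConv.toConv (AddMonoidAlgebra.mapDomainBialgHom k f :
        AddMonoidAlgebra k M →ₐ[k] AddMonoidAlgebra k N) *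
      WithConv.toConv (AddMonoidAlgebra.mapDomainBialgHom k g :
        AddMonoidAlgebra k M →ₐ[k] AddMonoidAlgebra k N) := by
    apply WithConv.ofConv_injective
    refine AddMonoidAlgebra.algHom_ext (fun m : M ↦ ?_) (Subsingleton.elim _ _)
    refine Eq.trans ?_ (AddMonoidAlgebra.convMul_algHom_single_one _ _ m).symm
    simp [AddMonoidAlgebra.single_mul_single]
  have h := map_mul (Spec.mapMulEquiv (R := k) (S := AddMonoidAlgebra k M)
    (T := AddMonoidAlgebra k N)) (WithConv.toConv (AddMonoidAlgebra.mapDomainBialgHom k f :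
        AddMonoidAlgebra k M →ₐ[k] AddMonoidAlgebra k N))
      (WithConv.toConv (AddMonoidAlgebra.mapDomainBialgHom k g :
        AddMonoidAlgebra k M →ₐ[k] AddMonoidAlgebra k N))
  rw [← key] at h
  exact h

lemma pow_eq_diagMap (M : Type) [AddCommGroup M] (d : ℕ) :
    (𝟙 (diagGroup k M).X) ^ d = underlying (diagMap k (d • AddMonoidHom.id M)) := by
  have h1 : 𝟙 (diagGroup k M).X = underlying (diagMap k (AddMonoidHom.id M)) := by
    ext1
    rw [diagMap_left, AddMonoidAlgebra.mapDomainBialgHom_id]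
    exact Spec.map_id _ |>.symm
  induction d with
  | zero =>
    have := diagMap_add (k := k) (0 : M →+ M) 0
    rw [add_zero, left_eq_mul] at this
    rw [pow_zero, zero_smul, this]
  | succ d ih => rw [pow_succ, ih, add_smul, one_smul, diagMap_add, ← h1]

end Diagonalizable

section GroupLike

open TensorProduct Coalgebra

variable {k : Type*} [Field k] {B X : Type*} [CommRing B] [HopfAlgebra k B] [AddCommGroup X]

/-- The coefficient functional at `x` on the left factor of the comultiplication of `k[X]` extracts
the homogeneous component of degree `x`. -/
lemma coeff_rTensor_comul (x : X) (f : AddMonoidAlgebra k X) :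
    TensorProduct.lid k _ (((Finsupp.lapply x).comp
      (AddMonoidAlgebra.coeffLinearEquiv k).toLinearMap).rTensor _ (comul (R := k) f)) =
        AddMonoidAlgebra.single x (f.coeff x) := by
  classical
  induction f using AddMonoidAlgebra.induction_linear with
  | zero => simp
  | add f g hf hg => simp only [map_add, hf, hg, AddMonoidAlgebra.coeff_add, Finsupp.add_apply,
      AddMonoidAlgebra.single_add]
  | single y c =>
    rw [AddMonoidAlgebra.comul_single]
    by_cases h : y = x
    · subst h; simp
    · simp [Finsupp.single_eq_of_ne (Ne.symm h)]

/-- A Hopf subalgebra of a group algebra `k[X]` is the group algebra of a subgroup of `X`.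
Comparing the comultiplications shows that with an element the subalgebra contains its homogeneous
components, so it is spanned by the characters it contains. -/
lemma exists_bialgEquiv_of_injective (σ : B →ₐc[k] AddMonoidAlgebra k X)
    (hσ : Function.Injective σ) :
    ∃ X' : AddSubgroup X, Nonempty (AddMonoidAlgebra k X' ≃ₐc[k] B) := by
  classical
  let σl : B →ₗ[k] AddMonoidAlgebra k X := (σ : B →ₐ[k] AddMonoidAlgebra k X).toLinearMap
  have hσσ : Function.Injective (TensorProduct.map σl σl) :=
    TensorProduct.map_injective_of_flat_flat _ _ hσ hσ
  have hcomul (b : B) : TensorProduct.map σl σl (comul b) =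
      comul (σ b) := CoalgHomClass.map_comp_comul_apply σ b
  have hgl {b : B} {x : X} (h : σ b = AddMonoidAlgebra.single x 1) : IsGroupLikeElem k b := by
    refine ⟨by rw [← CoalgHomClass.counit_comp_apply σ, h]; simp, hσσ ?_⟩
    rw [hcomul, h, TensorProduct.map_tmul, show σl b = _ from h]
    simp
  -- the subalgebra contains the homogeneous components of its elements
  have hcomp (b : B) (x : X) :
      ∃ b', σ b' = AddMonoidAlgebra.single x ((σ b).coeff x) := by
    rw [← coeff_rTensor_comul, ← hcomul]
    generalize (comul b : B ⊗[k] B) = t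
    induction t with
    | zero => exact ⟨0, by simp⟩
    | tmul b c => exact ⟨((σ b).coeff x) • c, by simp; rfl⟩
    | add t u ht hu =>
      obtain ⟨b, hb⟩ := ht
      obtain ⟨c, hc⟩ := hu
      exact ⟨b + c, by simp only [map_add, hb, hc]⟩
  -- the characters contained in the subalgebra; the antipode supplies inverses
  let X' : AddSubgroup X :=
    { carrier := {x | ∃ b, σ b = AddMonoidAlgebra.single x 1}
      zero_mem' := ⟨1, by rw [map_one]; rfl⟩
      add_mem' := by
        rintro x y ⟨b, hb⟩ ⟨c, hc⟩
        exact ⟨b * c, by rw [map_mul, hb, hc, AddMonoidAlgebra.single_mul_single, one_mul]⟩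
      neg_mem' := by
        rintro x ⟨b, hb⟩
        refine ⟨HopfAlgebra.antipode k b, ?_⟩
        have h1 := congrArg σ (hgl hb).mul_antipode_cancel
        rw [map_mul, map_one, hb] at h1
        have h2 : AddMonoidAlgebra.single (-x) (1 : k) * AddMonoidAlgebra.single x 1 = 1 := by
          rw [AddMonoidAlgebra.single_mul_single, neg_add_cancel, one_mul]; rfl
        exact (left_inv_eq_right_inv h2 h1).symm }
  choose g hg using fun x : X' ↦ x.2
  let gh : Multiplicative X' →* B :=
    { toFun := fun x ↦ g (Multiplicative.toAdd x)
      map_one' := hσ ((hg 0).trans (map_one σ).symm)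
      map_mul' := fun x y ↦ hσ <|
        (hg (Multiplicative.toAdd x + Multiplicative.toAdd y)).trans <| by
          rw [map_mul, hg, hg, AddMonoidAlgebra.single_mul_single, one_mul]; rfl }
  have hlift (x : X') : AddMonoidAlgebra.lift k B X' gh (AddMonoidAlgebra.single x 1) = g x := by
    simp [gh]
  let Θ : AddMonoidAlgebra k X' →ₐc[k] B := .ofAlgHom (AddMonoidAlgebra.lift k B X' gh)
    (by
      refine AddMonoidAlgebra.algHom_ext (fun x ↦ ?_) (Subsingleton.elim _ _)
      rw [AlgHom.comp_apply, hlift]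
      simpa using (hgl (hg x)).counit_eq_one)
    (by
      refine AddMonoidAlgebra.algHom_ext (fun x ↦ ?_) (Subsingleton.elim _ _)
      rw [AlgHom.comp_apply, AlgHom.comp_apply, hlift]
      have := (hgl (hg x)).comul_eq_tmul_self
      simp only [Bialgebra.comulAlgHom_apply, this, AddMonoidAlgebra.comul_single]
      simp [gh])
  have hΘ (x : X') (c : k) :
      σ (Θ (AddMonoidAlgebra.single x c)) = AddMonoidAlgebra.single x.1 c := by
    have e : AddMonoidAlgebra.single x c = c • AddMonoidAlgebra.single x (1 : k) := by simp
    rw [e, map_smul, map_smul]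
    have : Θ (AddMonoidAlgebra.single x 1) = g x := hlift x
    rw [this, hg]
    simp
  have hΘ' (f : AddMonoidAlgebra k X') :
      σ (Θ f) = AddMonoidAlgebra.mapDomain X'.subtype f := by
    induction f using AddMonoidAlgebra.induction_linear with
    | zero => simp
    | add f g hf hg => rw [map_add, map_add, hf, hg, AddMonoidAlgebra.mapDomain_add]
    | single x c => rw [hΘ]; simp
  refine ⟨X', ⟨BialgEquiv.ofBijective Θ ⟨?_, fun b ↦ ?_⟩⟩⟩
  · intro f f' h
    have := congrArg σ h
    rw [hΘ', hΘ'] at this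
    exact AddMonoidAlgebra.mapDomain_injective Subtype.val_injective this
  · suffices h : σ b ∈ LinearMap.range (σl.comp (Θ : AddMonoidAlgebra k X' →ₐ[k] B).toLinearMap) by
      obtain ⟨f, hf⟩ := h
      exact ⟨f, hσ hf⟩
    rw [← AddMonoidAlgebra.sum_coeff_single (σ b)]
    refine Submodule.sum_mem _ fun x hx ↦ ?_
    have hx' : (σ b).coeff x ≠ 0 := Finsupp.mem_support_iff.mp hx
    obtain ⟨b', hb'⟩ := hcomp b x
    have hxX : x ∈ X' := ⟨((σ b).coeff x)⁻¹ • b', by simp [hb', hx']⟩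
    exact ⟨AddMonoidAlgebra.single ⟨x, hxX⟩ ((σ b).coeff x), hΘ _ _⟩

end GroupLike

end HopfSubalgebras

/-! ### Surjectivity of homomorphisms into connected groups -/

section FiniteKernel

variable {k : Type u} [Field k]

/-- The algebra `k[M]` is finite over itself along the `d`-th power map, since the `d`-th power of
every monomial lies in the image. -/
lemma finite_mapDomainBialgHom_smul (M : Type) [AddCommGroup M] [AddGroup.FG M] {d : ℕ}
    (hd : 0 < d) :
    (AddMonoidAlgebra.mapDomainBialgHom k (d • AddMonoidHom.id M) :
      AddMonoidAlgebra k M →+* AddMonoidAlgebra k M).Finite := by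
  set f : AddMonoidAlgebra k M →+* AddMonoidAlgebra k M :=
    (AddMonoidAlgebra.mapDomainBialgHom k (d • AddMonoidHom.id M) :
      AddMonoidAlgebra k M →+* AddMonoidAlgebra k M) with hf
  have hfs (x : M) (c : k) :
      f (AddMonoidAlgebra.single x c) = AddMonoidAlgebra.single (d • x) c :=
    AddMonoidAlgebra.mapDomainBialgHom_single _ x c
  refine RingHom.IsIntegral.to_finite (fun a ↦ ?_) ?_
  · induction a using AddMonoidAlgebra.induction_linear with
    | zero => exact RingHom.isIntegralElem_zero f
    | add a b ha hb => exact RingHom.IsIntegralElem.add f ha hb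
    | single x c =>
      have : f.IsIntegralElem (AddMonoidAlgebra.single x c ^ d) := by
        rw [AddMonoidAlgebra.single_pow, ← hfs]
        exact RingHom.isIntegralElem_map f
      obtain ⟨q, hq, hq'⟩ := this
      refine ⟨q.comp (Polynomial.X ^ d), hq.comp (Polynomial.monic_X_pow d) (by simpa using hd.ne'),
        ?_⟩
      rw [Polynomial.eval₂_comp]
      simpa using hq'
  · refine RingHom.FiniteType.of_comp_finiteType
      (f := algebraMap k (AddMonoidAlgebra k M)) ?_
    have : f.comp (algebraMap k (AddMonoidAlgebra k M)) =
        algebraMap k (AddMonoidAlgebra k M) :=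
      (AddMonoidAlgebra.mapDomainBialgHom k (d • AddMonoidHom.id M) :
        AddMonoidAlgebra k M →ₐ[k] AddMonoidAlgebra k M).comp_algebraMap
    rw [this, RingHom.finiteType_algebraMap]
    infer_instance

lemma isFinite_pow (n : ℕ) {d : ℕ} (hd : 0 < d) : IsFinite ((𝟙 (Gm k n).X) ^ d).left := by
  rw [pow_eq_diagMap]
  exact (IsFinite.SpecMap_iff _).mpr (finite_mapDomainBialgHom_smul (k := k) (Fin n → ℤ) hd)

lemma surjective_pow (n : ℕ) {d : ℕ} (hd : 0 < d) : Surjective ((𝟙 (Gm k n).X) ^ d).left := by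
  rw [pow_eq_diagMap]
  refine ⟨RingHom.IsIntegral.comap_surjective
    (finite_mapDomainBialgHom_smul (k := k) (Fin n → ℤ) hd).to_isIntegral ?_⟩
  refine AddMonoidAlgebra.mapDomain_injective (f := fun x : Fin n → ℤ ↦ d • x) fun x y h ↦ ?_
  exact smul_right_injective _ hd.ne' h

variable [IsAlgClosed k]

lemma exists_pt_lift {X Y : Over (Spec (.of k))} [LocallyOfFiniteType X.hom]
    [LocallyOfFiniteType Y.hom] (f : X ⟶ Y) {y : 𝟙_ _ ⟶ Y} (h : pt y ∈ Set.range f.left) :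
    ∃ x : 𝟙_ _ ⟶ X, x ≫ f = y := by
  obtain ⟨p, hp⟩ := h
  obtain ⟨x, hx⟩ := exists_pt_mem (X := X) (S := f.left ⁻¹' {pt y})
    ((isClosed_pt y).preimage f.left.continuous).isLocallyClosed ⟨p, hp⟩
  exact ⟨x, pt_injective hx⟩

/-- A homomorphism `s : Q ⟶ T` with closed image into a connected group is surjective as soon as
some homomorphism `p : T ⟶ Q` with finitely many rational points in its kernel makes `s ≫ p`
surjective: the finitely many translates of the image by points of the kernel of `p` cover `T`, so
the image is both open and closed. -/
lemma surjective_of_finite_kernel {T Q : GroupScheme k} [PreconnectedSpace T.X.left]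
    [LocallyOfFiniteType T.X.hom] [LocallyOfFiniteType Q.X.hom] (p : T ⟶ Q) (s : Q ⟶ T)
    [hfin : Finite {x : 𝟙_ _ ⟶ T.X // x ≫ underlying p = 1}]
    (hs : IsClosed (Set.range (underlying s).left))
    (hsp : Surjective (underlying s ≫ underlying p).left) : Surjective (underlying s).left := by
  let tr (y : 𝟙_ _ ⟶ T.X) : T.X ⟶ T.X := 𝟙 T.X * (toUnit _ ≫ y)
  have htr (x y : 𝟙_ _ ⟶ T.X) : x ≫ tr y = x * y := by
    rw [MonObj.comp_mul, Category.comp_id, ← Category.assoc]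
    congr 1
    rw [toUnit_unique (x ≫ toUnit T.X) (𝟙 _), Category.id_comp]
  set Z := Set.range (underlying s).left with hZ
  have hmem (x : 𝟙_ _ ⟶ T.X) : pt x ∈ Z ↔ ∃ y : 𝟙_ _ ⟶ Q.X, y ≫ underlying s = x := by
    refine ⟨exists_pt_lift _, ?_⟩
    rintro ⟨y, rfl⟩
    exact ⟨_, (pt_comp _ _).symm⟩
  -- the union of the translates of `Z` by points of the kernel outside `Z`
  let W : Set T.X.left := ⋃ x : {x : 𝟙_ _ ⟶ T.X // x ≫ underlying p = 1}, ⋃ (_ : pt x.1 ∉ Z),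
    (tr x.1⁻¹).left ⁻¹' Z
  have hW : IsClosed W := isClosed_iUnion_of_finite fun x ↦ isClosed_iUnion_of_finite fun _ ↦
    hs.preimage (tr x.1⁻¹).left.continuous
  have hWmem (y : 𝟙_ _ ⟶ T.X) : pt y ∈ W ↔ ∃ x : 𝟙_ _ ⟶ T.X, x ≫ underlying p = 1 ∧ pt x ∉ Z ∧
      pt (y * x⁻¹) ∈ Z := by
    simp only [W, Set.mem_iUnion, Set.mem_preimage, ← pt_comp, htr, Subtype.exists, exists_prop]
  have hun : Z ∪ W = Set.univ := by
    refine eq_univ_of_isClosed (hs.union hW) fun t ↦ ?_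
    by_cases ht : pt t ∈ Z
    · exact .inl ht
    · obtain ⟨y, hy⟩ := exists_pt_lift (underlying s ≫ underlying p) (y := t ≫ underlying p)
        (hsp.surj _)
      refine .inr ((hWmem t).mpr ⟨(y ≫ underlying s)⁻¹ * t, ?_, ?_, ?_⟩)
      · rw [MonObj.mul_comp, GrpObj.inv_comp, Category.assoc, hy, inv_mul_cancel]
      · rw [hmem]
        rintro ⟨y', hy'⟩
        refine ht ((hmem t).mpr ⟨y * y', ?_⟩)
        rw [MonObj.mul_comp, hy', mul_inv_cancel_left]
      · rw [mul_inv_rev, inv_inv, mul_inv_cancel_left, hmem]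
        exact ⟨y, rfl⟩
  have hdisj : Disjoint Z W := by
    rw [Set.disjoint_iff_inter_eq_empty]
    by_contra hne
    obtain ⟨t, ht1, ht2⟩ := exists_pt_mem (hs.inter hW).isLocallyClosed
      (Set.nonempty_iff_ne_empty.mpr hne)
    obtain ⟨x, hx, hxZ, hxt⟩ := (hWmem t).mp ht2
    obtain ⟨y, hy⟩ := (hmem _).mp ht1
    obtain ⟨y', hy'⟩ := (hmem _).mp hxt
    refine hxZ ((hmem _).mpr ⟨y'⁻¹ * y, ?_⟩)
    rw [MonObj.mul_comp, GrpObj.inv_comp, hy, hy', mul_inv_rev, inv_inv, inv_mul_cancel_right]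
  have hZo : IsOpen Z := by
    rw [show Z = Wᶜ from (IsCompl.of_eq hdisj.inter_eq hun).eq_compl]
    exact hW.isOpen_compl
  refine ⟨Set.range_eq_univ.mp (IsClopen.eq_univ ⟨hs, hZo⟩ ?_)⟩
  exact ⟨_, Set.mem_range_self (pt 1)⟩

end FiniteKernel

/-! ### Diagonalizability of the identity component -/

section Diagonalizability

variable {k : Type u} [Field k]

lemma injective_of_surjective_specMap {A B : Type u} [CommRing A] [CommRing B]
    [IsReduced (Spec (.of A))] (f : A →+* B) (h : Surjective (Spec.map (CommRingCat.ofHom f))) :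
    Function.Injective f := by
  have hA : _root_.IsReduced A := affine_isReduced_iff _ |>.mp ‹_›
  have h1 := (PrimeSpectrum.denseRange_comap_iff_ker_le_nilRadical _).mp h.surj.denseRange
  rw [nilradical_eq_zero] at h1
  exact (RingHom.injective_iff_ker_eq_bot _).mpr (le_bot_iff.mp h1)

lemma exists_bialgEquiv_of_surjective_specMap {B : Type u} [CommRing B] [HopfAlgebra k B] {M : Type}
    [AddCommGroup M] [IsReduced (Spec (.of B))] (σ : B →ₐc[k] AddMonoidAlgebra k M)
    (h : Surjective (Spec.map (CommRingCat.ofHom (σ : B →+* AddMonoidAlgebra k M)))) :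
    ∃ X' : AddSubgroup M, Nonempty (AddMonoidAlgebra k X' ≃ₐc[k] B) :=
  exists_bialgEquiv_of_injective σ (injective_of_surjective_specMap _ h)

lemma exists_hopfSpec_iso_diagGroup {B : CommHopfAlgCat k} {M : Type} [AddCommGroup M]
    (hB : IsReduced ((hopfSpec (.of k)).obj (.op B)).X.left)
    (s : diagGroup k M ⟶ (hopfSpec (.of k)).obj (.op B)) (hs : Surjective (underlying s).left) :
    ∃ X' : AddSubgroup M, Nonempty ((hopfSpec (.of k)).obj (.op B) ≅ diagGroup k X') := by
  obtain ⟨σ, rfl⟩ : ∃ σ, (hopfSpec (.of k)).map σ = s :=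
    ⟨_, (hopfSpec.fullyFaithful (R := .of k)).map_preimage s⟩
  have : IsReduced (Spec (.of B)) := hB
  obtain ⟨X', ⟨b⟩⟩ := exists_bialgEquiv_of_surjective_specMap σ.unop.hom hs
  exact ⟨X', ⟨(hopfSpec (.of k)).mapIso (CommHopfAlgCat.isoMk b).op⟩⟩

/-- A reduced affine group scheme admitting a surjective homomorphism from a diagonalizable group
is diagonalizable. -/
lemma exists_iso_diagGroup {T : GroupScheme k} {M : Type} [AddCommGroup M]
    [hT : IsAffine T.X.left] [IsReduced T.X.left] (s : diagGroup k M ⟶ T)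
    (hs : Surjective (underlying s).left) :
    ∃ X' : AddSubgroup M, Nonempty (T ≅ diagGroup k X') := by
  obtain ⟨B, ⟨e⟩⟩ : ∃ B : CommHopfAlgCat k, Nonempty ((hopfSpec (.of k)).obj (.op B) ≅ T) := by
    have h := essImage_hopfSpec (R := .of k) |>.mpr hT
    exact ⟨h.witness.unop, ⟨h.getIso⟩⟩
  have he : IsIso (underlying e.hom).left :=
    inferInstanceAs (IsIso ((Grp.forget _ ⋙ Over.forget _).map e.hom))
  have he' : IsIso (underlying e.inv).left :=
    inferInstanceAs (IsIso ((Grp.forget _ ⋙ Over.forget _).map e.inv))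
  obtain ⟨X', ⟨b⟩⟩ := exists_hopfSpec_iso_diagGroup
    (isReduced_of_isOpenImmersion (underlying e.hom).left) (s ≫ e.inv)
    (inferInstanceAs (Surjective ((underlying s).left ≫ (underlying e.inv).left)))
  exact ⟨X', ⟨e.symm ≪≫ b⟩⟩

section Extension

variable {n : ℕ} {G Γ T : GroupScheme k} {i : G ⟶ Γ} {π : Γ ⟶ Gm k n} {j : T ⟶ Γ}

lemma isFinite_identityComponent (hG : IsFiniteEtale G) (hex : IsShortExact i π)
    (hj : IsIdentityComponent j) : IsFinite (underlying (j ≫ π)).left := by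
  have := hex.isFinite hG.etale hG.finite
  have := hj.isOpenImmersion
  have : IsClosedImmersion (underlying j).left :=
    .of_isPreimmersion _ (hj.range_eq ▸ isClosed_connectedComponent)
  exact inferInstanceAs (IsFinite ((underlying j).left ≫ (underlying π).left))

lemma etale_identityComponent (hG : IsFiniteEtale G) (hex : IsShortExact i π)
    (hj : IsIdentityComponent j) : Etale (underlying (j ≫ π)).left := by
  have := hex.etale hG.etale
  have := hj.isOpenImmersion
  exact inferInstanceAs (Etale ((underlying j).left ≫ (underlying π).left))

variable [IsAlgClosed k]

lemma finite_points (hG : IsFiniteEtale G) : Finite (𝟙_ _ ⟶ G.X) := by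
  have := hG.finite
  have := discreteTopology_of_isFiniteEtale hG
  have : CompactSpace G.X.left := QuasiCompact.compactSpace_of_compactSpace G.X.hom
  have : Finite G.X.left := finite_of_compact_of_discrete
  exact Finite.of_injective pt pt_injective

/-- A finite étale group scheme is killed by the number of its rational points. -/
lemma pow_card_points_eq_one (hG : IsFiniteEtale G) {S : Over (Spec (.of k))} (g : S ⟶ G.X) :
    g ^ Nat.card (𝟙_ _ ⟶ G.X) = 1 := by
  have := hG.finite
  have := hG.isReduced
  have h : (𝟙 G.X) ^ Nat.card (𝟙_ _ ⟶ G.X) = 1 := by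
    refine ext_pts fun x ↦ ?_
    rw [comp_pow', Category.comp_id, MonObj.comp_one, pow_card_eq_one']
  have := congr(g ≫ $h)
  rwa [comp_pow', Category.comp_id, MonObj.comp_one] at this

/-- The identity component of the extension is diagonalizable: the power map by the order of `G`
descends to the torus and exhibits the identity component as a quotient of it. -/
lemma exists_identityComponent_iso_diagGroup (hG : IsFiniteEtale G) [LocallyOfFiniteType Γ.X.hom]
    (hex : IsShortExact i π) (hj : IsIdentityComponent j) :
    ∃ X' : AddSubgroup (Fin n → ℤ), Nonempty (T ≅ diagGroup k X') := by
  have h1 := isFinite_identityComponent hG hex hj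
  have h2 := etale_identityComponent hG hex hj
  have h3 := surjective_identityComponent hG hex hj
  have h4 := hj.preconnectedSpace
  have h5 := hj.isOpenImmersion
  have h6 := finite_points hG
  have hT : LocallyOfFiniteType T.X.hom := by rw [← Over.w (underlying j)]; infer_instance
  have : Mono (underlying j) := Over.mono_of_mono_left _
  have : IsReduced T.X.left := isReduced_of_etale (underlying (j ≫ π)).left
  have : IsAffine T.X.left := isAffine_of_isAffineHom (underlying (j ≫ π)).left
  obtain ⟨s, hs1, hs2⟩ := exists_descent_pow (i := i) (isCentral_identityComponent hG hex hj)
    hex.isKernel (fun S g ↦ pow_card_points_eq_one hG g) ⟨⟨h3, inferInstance⟩, inferInstance⟩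
  have hd : 0 < Nat.card (𝟙_ _ ⟶ G.X) := Nat.card_pos
  refine exists_iso_diagGroup s ?_
  have : Finite {x : 𝟙_ _ ⟶ T.X // x ≫ underlying (j ≫ π) = 1} := by
    choose g hg using fun x : {x : 𝟙_ _ ⟶ T.X // x ≫ underlying (j ≫ π) = 1} ↦
      IsKernel.exists_lift (i := i) (q := π) hex.isKernel (x.1 ≫ underlying j) x.2
    refine Finite.of_injective g fun x y h ↦ Subtype.ext ?_
    rw [← cancel_mono (underlying j), ← hg, ← hg, h]
  refine surjective_of_finite_kernel (j ≫ π) s ?_ ?_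
  · have h7 := isFinite_pow (k := k) n hd
    rw [← hs2] at h7
    have : IsFinite ((underlying s).left ≫ (underlying (j ≫ π)).left) := h7
    have := IsFinite.of_comp (underlying s).left (underlying (j ≫ π)).left
    exact (underlying s).left.isClosedMap.isClosed_range
  · rw [hs2]
    exact surjective_pow n hd

end Extension

end Diagonalizability

/-! ### Smith normal form -/

section NormalForm

section SmithNormalForm

/-- The automorphism of `ℤⁿ` acting on the coordinates `p ≠ q` through the matrix `!![a, b; c, d]`
of determinant one. -/
def twoByTwo {n : ℕ} {p q : Fin n} (hpq : p ≠ q) (a b c d : ℤ) (h : a * d - b * c = 1) :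
    (Fin n → ℤ) ≃+ (Fin n → ℤ) where
  toFun z := Function.update (Function.update z p (a * z p + b * z q)) q (c * z p + d * z q)
  invFun z := Function.update (Function.update z p (d * z p - b * z q)) q (-c * z p + a * z q)
  left_inv z := by
    ext t
    by_cases htq : t = q
    · subst htq
      simp [hpq]
      linear_combination (z t) * h
    · by_cases htp : t = p
      · subst htp
        simp [hpq]
        linear_combination (z t) * h
      · simp [htp, htq]
  right_inv z := by
    ext t
    by_cases htq : t = q
    · subst htq
      simp [hpq]
      linear_combination (z t) * h
    · by_cases htp : t = p
      · subst htp
        simp [hpq]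
        linear_combination (z t) * h
      · simp [htp, htq]
  map_add' z w := by
    ext t
    by_cases htq : t = q
    · subst htq
      simp
      ring
    · by_cases htp : t = p
      · subst htp
        simp [hpq]
        ring
      · simp [htp, htq]

variable {n : ℕ} {M : Type*} [AddCommGroup M]

/-- In suitable bases `e` of the target and `v` of the source, `f` is the diagonal map with entries
`r`. -/
def IsDiagonalizedBy (f : (Fin n → ℤ) →+ M) (r : Fin n → ℕ) : Prop :=
  ∃ (e : M ≃+ (Fin n → ℤ)) (v : (Fin n → ℤ) ≃+ (Fin n → ℤ)), ∀ x a, e (f x) a = r a * v x a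

/-- Two diagonal entries may be replaced by their greatest common divisor and least common
multiple. With `x * r p + y * r q = g` a Bézout relation, `r p = g * a'` and `r q = g * b'`, the
bases change by `!![x, y; -b', a']` on the target and `!![x * a', y * b'; -1, 1]` on the source. -/
lemma IsDiagonalizedBy.gcd_lcm {f : (Fin n → ℤ) →+ M} {r : Fin n → ℕ} (h : IsDiagonalizedBy f r)
    {p q : Fin n} (hpq : p ≠ q) :
    IsDiagonalizedBy f
      (Function.update (Function.update r p ((r p).gcd (r q))) q ((r p).lcm (r q))) := by
  obtain ⟨e, v, hev⟩ := h
  by_cases h0 : (r p).gcd (r q) = 0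
  · have h1 : r p = 0 := Nat.eq_zero_of_gcd_eq_zero_left h0
    have h2 : r q = 0 := Nat.eq_zero_of_gcd_eq_zero_right h0
    refine ⟨e, v, fun x a ↦ ?_⟩
    rw [hev]
    by_cases htq : a = q
    · subst htq; simp [h1, h2]
    · by_cases htp : a = p
      · subst htp; simp [hpq, h1, h2]
      · simp [htp, htq]
  obtain ⟨a', ha'⟩ := Nat.gcd_dvd_left (r p) (r q)
  obtain ⟨b', hb'⟩ := Nat.gcd_dvd_right (r p) (r q)
  have hbez := Nat.gcd_eq_gcd_ab (r p) (r q)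
  set x := Nat.gcdA (r p) (r q)
  set y := Nat.gcdB (r p) (r q)
  set g := (r p).gcd (r q) with hg
  have hl : (r p).lcm (r q) = g * a' * b' := by
    apply Nat.eq_of_mul_eq_mul_left (Nat.pos_of_ne_zero h0)
    rw [hg, Nat.gcd_mul_lcm, ← hg]
    nth_rw 1 [ha', hb']
    ring
  have haz : (r p : ℤ) = g * a' := by exact_mod_cast ha'
  have hbz : (r q : ℤ) = g * b' := by exact_mod_cast hb'
  have h1 : x * a' + y * b' = 1 := by
    have : (g : ℤ) ≠ 0 := by exact_mod_cast h0
    apply mul_left_cancel₀ this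
    rw [haz, hbz] at hbez
    linear_combination -hbez
  refine ⟨e.trans (twoByTwo hpq x y (-b') a' (by linear_combination h1)),
    v.trans (twoByTwo hpq (x * a') (y * b') (-1) 1 (by linear_combination h1)), fun z t ↦ ?_⟩
  simp only [AddEquiv.trans_apply, twoByTwo, AddEquiv.coe_mk, Equiv.coe_fn_mk]
  by_cases htq : t = q
  · subst htq
    simp [hev, hl, haz, hbz]
    ring
  · by_cases htp : t = p
    · subst htp
      simp [hpq, hev, haz, hbz]
      ring
    · simp [htp, htq, hev]

/-- Diagonal form without divisibility of the entries. The signs `ε` of the diagonal entries are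
absorbed into the basis of the source. -/
lemma exists_isDiagonalizedBy [Module.Free ℤ M] [Module.Finite ℤ M]
    (hM : Module.finrank ℤ M = n) (f : (Fin n → ℤ) →+ M) (hf : Function.Injective f) :
    ∃ r, (∀ a, 0 < r a) ∧ IsDiagonalizedBy f r := by
  let b := Module.finBasisOfFinrankEq ℤ M hM
  let fl := f.toIntLinearMap
  have hfl : Function.Injective fl := hf
  let fe := LinearEquiv.ofInjective fl hfl
  have hr : Module.finrank ℤ (LinearMap.range fl) = Module.finrank ℤ M := by
    rw [← fe.finrank_eq, hM]; simp
  obtain ⟨b', a, ab, hab⟩ := Submodule.exists_smith_normal_form_of_rank_eq b hr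
  choose ε hε using fun i ↦ Int.associated_natAbs (a i)
  have hε' (i : Fin n) : a i = (a i).natAbs * ((ε i)⁻¹ : ℤˣ) :=
    (Units.eq_mul_inv_iff_mul_eq _).mpr (hε i)
  refine ⟨fun i ↦ (a i).natAbs, fun i ↦ ?_, b'.equivFun.toAddEquiv,
    (fe.trans ab.equivFun).toAddEquiv.trans
      (AddEquiv.piCongrRight fun i ↦ DistribMulAction.toAddEquiv ℤ (ε i)⁻¹), fun x t ↦ ?_⟩
  · rw [Int.natAbs_pos]
    intro h
    have := hab i
    rw [h, zero_smul] at this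
    exact ab.ne_zero i (Subtype.ext this)
  · have h1 : f x = ∑ i, (ab.equivFun (fe x) i * a i) • b' i := by
      have := congrArg Subtype.val (ab.sum_equivFun (fe x))
      rw [AddSubmonoidClass.coe_finsetSum] at this
      refine Eq.trans this.symm ?_
      simp [hab, mul_smul]
    change b'.equivFun (f x) t = (a t).natAbs * (((ε t)⁻¹ : ℤˣ) • ab.equivFun (fe x) t)
    rw [h1, b'.equivFun_apply, Module.Basis.repr_sum_self, Units.smul_def, smul_eq_mul]
    linear_combination ab.equivFun (fe x) t * hε' t

/-- Smith normal form, with divisibility, for an injective map of lattices of the same rank: the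
lexicographically smallest diagonal form has the divisibility property. -/
lemma exists_isDiagonalizedBy_dvd [Module.Free ℤ M] [Module.Finite ℤ M]
    (hM : Module.finrank ℤ M = n) (f : (Fin n → ℤ) →+ M) (hf : Function.Injective f) :
    ∃ r, (∀ a, 0 < r a) ∧ (∀ a b, a ≤ b → r a ∣ r b) ∧ IsDiagonalizedBy f r := by
  let S : Set (Lex (Fin n → ℕ)) := {r | (∀ a, 0 < ofLex r a) ∧ IsDiagonalizedBy f (ofLex r)}
  have hS : S.Nonempty := exists_isDiagonalizedBy hM f hf
  obtain ⟨r, hrS, hmin⟩ := WellFounded.has_min (wellFounded_lt (α := Lex (Fin n → ℕ))) S hS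
  refine ⟨ofLex r, hrS.1, fun a b hab ↦ ?_, hrS.2⟩
  by_contra hdvd
  have hne : a ≠ b := by rintro rfl; exact hdvd dvd_rfl
  set g := (ofLex r a).gcd (ofLex r b) with hg
  -- replacing the two entries by their gcd and lcm decreases `r` lexicographically
  let r' : Lex (Fin n → ℕ) := toLex (Function.update (Function.update (ofLex r) a g) b
    ((ofLex r a).lcm (ofLex r b)))
  refine hmin r' ⟨fun t ↦ ?_, hrS.2.gcd_lcm hne⟩ ⟨a, fun t ht ↦ ?_, ?_⟩
  · change 0 < Function.update (Function.update (ofLex r) a g) b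
      ((ofLex r a).lcm (ofLex r b)) t
    by_cases htb : t = b
    · subst htb; simpa using Nat.lcm_pos (hrS.1 a) (hrS.1 t)
    · by_cases hta : t = a
      · subst hta; rw [Function.update_of_ne htb, Function.update_self]
        exact Nat.gcd_pos_of_pos_left _ (hrS.1 t)
      · simpa [htb, hta] using hrS.1 t
  · have h1 : t ≠ a := ht.ne
    have h2 : t ≠ b := (ht.trans_le hab).ne
    change Function.update (Function.update (ofLex r) a g) b
      ((ofLex r a).lcm (ofLex r b)) t = ofLex r t
    simp [h1, h2]
  · change Function.update (Function.update (ofLex r) a g) b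
      ((ofLex r a).lcm (ofLex r b)) a < ofLex r a
    rw [Function.update_of_ne hne, Function.update_self]
    refine lt_of_le_of_ne (Nat.gcd_le_left _ (hrS.1 a)) fun h ↦ hdvd ?_
    exact Nat.gcd_eq_left_iff_dvd.mp h

end SmithNormalForm

end NormalForm

/-! ### Invariant factors and character groups -/

section CharacterGroups

section InvariantFactors

variable {n : ℕ}

lemma card_torsion_pi_zmod (r : Fin n → ℕ) (hr : ∀ a, 0 < r a) (m : ℕ) :
    Nat.card {x : ∀ a, ZMod (r a) // m • x = 0} = ∏ a, (r a).gcd m := by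
  have e : {x : ∀ a, ZMod (r a) // m • x = 0} ≃ ∀ a, {x : ZMod (r a) // m • x = 0} :=
    (Equiv.subtypeEquivRight fun x ↦ by simp [funext_iff]).trans
      (Equiv.subtypePiEquivPi (p := fun {a} (x : ZMod (r a)) ↦ m • x = 0))
  rw [Nat.card_congr e, Nat.card_pi]
  refine Finset.prod_congr rfl fun a _ ↦ ?_
  have : NeZero (r a) := ⟨(hr a).ne'⟩
  have := IsAddCyclic.card_nsmulAddMonoidHom_ker (ZMod (r a)) m
  rw [Nat.card_zmod] at this
  exact this

/-- The invariant factors of a finite abelian group are unique. -/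
lemma eq_of_pi_zmod_addEquiv (r r' : Fin n → ℕ) (hr : ∀ a, 0 < r a)
    (hdvd : ∀ a b, a ≤ b → r a ∣ r b) (hdvd' : ∀ a b, a ≤ b → r' a ∣ r' b)
    (e : (∀ a, ZMod (r a)) ≃+ (∀ a, ZMod (r' a))) : r' = r := by
  -- `ZMod 0 = ℤ` is infinite
  have hr' (a : Fin n) : 0 < r' a := by
    have (a : Fin n) : NeZero (r a) := ⟨(hr a).ne'⟩
    have : Finite (∀ a, ZMod (r' a)) := Finite.of_equiv _ e.toEquiv
    have : Finite (ZMod (r' a)) := Finite.of_surjective (fun x : ∀ a, ZMod (r' a) ↦ x a)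
      (Function.surjective_eval a)
    refine Nat.pos_of_ne_zero fun h ↦ ?_
    rw [h] at this
    exact (Infinite.not_finite (α := ℤ)) this
  have hcard (m : ℕ) : ∏ a, (r a).gcd m = ∏ a, (r' a).gcd m := by
    rw [← card_torsion_pi_zmod r hr, ← card_torsion_pi_zmod r' hr']
    exact Nat.card_congr (e.toEquiv.subtypeEquiv fun x ↦ by
      change _ ↔ m • e x = 0
      rw [← map_nsmul, EmbeddingLike.map_eq_zero_iff])
  -- if `s` and `t` agree below `a`, then counting `t a`-torsion shows `t a ∣ s a`
  have key (s t : Fin n → ℕ) (ht : ∀ a, 0 < t a) (htd : ∀ a b, a ≤ b → t a ∣ t b)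
      (hst : ∀ m, ∏ a, (s a).gcd m = ∏ a, (t a).gcd m) (a : Fin n)
      (h : ∀ b < a, s b = t b) : t a ∣ s a := by
    have hle : ∀ b ∈ Finset.univ, (s b).gcd (t a) ≤ (t b).gcd (t a) := by
      intro b _
      rcases lt_or_ge b a with hb | hb
      · rw [h b hb]
      · rw [Nat.gcd_eq_right (htd a b hb)]
        exact Nat.gcd_le_right _ (ht a)
    have h1 : (s a).gcd (t a) = (t a).gcd (t a) := by
      by_contra hne
      refine (Finset.prod_lt_prod (fun b _ ↦ Nat.gcd_pos_of_pos_right _ (ht a)) hle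
        ⟨a, Finset.mem_univ a, lt_of_le_of_ne (hle a (Finset.mem_univ a)) hne⟩).ne (hst (t a))
    rw [Nat.gcd_self] at h1
    exact Nat.gcd_eq_right_iff_dvd.mp h1
  funext a
  induction a using WellFoundedLT.induction with
  | ind a ih =>
    exact Nat.dvd_antisymm (key r r' hr' hdvd' hcard a fun b hb ↦ (ih b hb).symm)
      (key r' r hr hdvd (fun m ↦ (hcard m).symm) a ih)

end InvariantFactors

section Duality

variable {k : Type u} [Field k] {L M N : Type} [AddCommGroup L] [AddCommGroup M] [AddCommGroup N]

lemma diagMap_comp (f : M →+ N) (g : L →+ M) :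
    diagMap k f ≫ diagMap k g = diagMap k (f.comp g) := by
  rw [diagMap, diagMap, diagMap, AddMonoidAlgebra.mapDomainBialgHom_comp]
  exact ((hopfSpec (.of k)).map_comp _ _).symm

lemma diagMap_id : diagMap k (AddMonoidHom.id M) = 𝟙 _ := by
  rw [diagMap, AddMonoidAlgebra.mapDomainBialgHom_id]
  exact (hopfSpec (.of k)).map_id _

variable (k) in
/-- The isomorphism of diagonalizable groups dual to an isomorphism of character groups. -/
noncomputable def diagIso (e : M ≃+ N) : diagGroup k N ≅ diagGroup k M where
  hom := diagMap k e.toAddMonoidHom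
  inv := diagMap k e.symm.toAddMonoidHom
  hom_inv_id := by
    rw [diagMap_comp, ← diagMap_id]
    congr 1
    ext; simp
  inv_hom_id := by
    rw [diagMap_comp, ← diagMap_id]
    congr 1
    ext; simp

/-- Homomorphisms of diagonalizable groups come from homomorphisms of character groups, since a
bialgebra homomorphism preserves grouplike elements. -/
lemma exists_eq_diagMap (q : diagGroup k N ⟶ diagGroup k M) : ∃ f : M →+ N, q = diagMap k f := by
  obtain ⟨σ, rfl⟩ : ∃ σ, (hopfSpec (.of k)).map σ = q :=
    ⟨_, (hopfSpec.fullyFaithful (R := .of k)).map_preimage q⟩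
  refine ⟨AddMonoidAlgebra.mapDomainBialgHomEquiv.symm σ.unop.hom, ?_⟩
  rw [diagMap]
  congr 1
  have := AddMonoidAlgebra.mapDomainBialgHomEquiv.apply_symm_apply σ.unop.hom
  change σ = (CommHopfAlgCat.ofHom (AddMonoidAlgebra.mapDomainBialgHomEquiv
    (AddMonoidAlgebra.mapDomainBialgHomEquiv.symm σ.unop.hom))).op
  rw [this]
  rfl

lemma diagMap_injective : Function.Injective (diagMap k : (M →+ N) → _) := by
  intro f g h
  have h1 := (hopfSpec.fullyFaithful (R := .of k)).map_injective h
  have h2 : AddMonoidAlgebra.mapDomainBialgHom k f = AddMonoidAlgebra.mapDomainBialgHom k g :=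
    congrArg (fun x ↦ x.unop.hom) h1
  exact AddMonoidAlgebra.mapDomainBialgHomEquiv.injective h2

/-- An isomorphism of diagonalizable groups induces an isomorphism of character groups. -/
lemma nonempty_addEquiv_of_iso (q : diagGroup k N ≅ diagGroup k M) : Nonempty (M ≃+ N) := by
  obtain ⟨f, hf⟩ := exists_eq_diagMap q.hom
  obtain ⟨g, hg⟩ := exists_eq_diagMap q.inv
  have h1 := q.hom_inv_id
  have h2 := q.inv_hom_id
  rw [hf, hg, diagMap_comp, ← diagMap_id] at h1 h2
  exact ⟨f.toAddEquiv g (diagMap_injective h2) (diagMap_injective h1)⟩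

lemma surjective_mapDomainBialgHom (h : N →+ L) (hs : Function.Surjective h) :
    Function.Surjective (AddMonoidAlgebra.mapDomainBialgHom k h :
      AddMonoidAlgebra k N →+* AddMonoidAlgebra k L) := by
  intro f
  induction f using AddMonoidAlgebra.induction_linear with
  | zero => exact ⟨0, map_zero _⟩
  | add a b ha hb =>
    obtain ⟨a, rfl⟩ := ha
    obtain ⟨b, rfl⟩ := hb
    exact ⟨a + b, map_add _ _ _⟩
  | single x c =>
    obtain ⟨x, rfl⟩ := hs x
    exact ⟨AddMonoidAlgebra.single x c, AddMonoidAlgebra.mapDomainBialgHom_single h x c⟩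

/-- For an exact sequence `M ⟶ N ⟶ L ⟶ 0`, the algebra `k[L]` is the fibre of `k[N]` over the unit
section of `Spec k[M]`. -/
lemma isPushout_of_exact (g : M →+ N) (h : N →+ L) (hs : Function.Surjective h)
    (hex : ∀ x, h x = 0 ↔ ∃ y, g y = x) :
    IsPushout
      (CommRingCat.ofHom (AddMonoidAlgebra.mapDomainBialgHom k g :
        AddMonoidAlgebra k M →+* AddMonoidAlgebra k N))
      (CommRingCat.ofHom (Bialgebra.counitAlgHom k (AddMonoidAlgebra k M) :
        AddMonoidAlgebra k M →+* k))
      (CommRingCat.ofHom (AddMonoidAlgebra.mapDomainBialgHom k h :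
        AddMonoidAlgebra k N →+* AddMonoidAlgebra k L))
      (CommRingCat.ofHom (algebraMap k (AddMonoidAlgebra k L))) := by
  have hsurj := surjective_mapDomainBialgHom (k := k) h hs
  have key (s : PushoutCocone (CommRingCat.ofHom (AddMonoidAlgebra.mapDomainBialgHom k g :
        AddMonoidAlgebra k M →+* AddMonoidAlgebra k N))
      (CommRingCat.ofHom (Bialgebra.counitAlgHom k (AddMonoidAlgebra k M) :
        AddMonoidAlgebra k M →+* k))) : ∃ ψ : AddMonoidAlgebra k L →+* s.pt,
      ψ.comp (AddMonoidAlgebra.mapDomainBialgHom k h :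
        AddMonoidAlgebra k N →+* AddMonoidAlgebra k L) = s.inl.hom ∧
      ψ.comp (algebraMap k (AddMonoidAlgebra k L)) = s.inr.hom := by
    have hc (f : AddMonoidAlgebra k M) :
        s.inl.hom (AddMonoidAlgebra.mapDomainBialgHom k g f) =
          s.inr.hom (Bialgebra.counitAlgHom k (AddMonoidAlgebra k M) f) :=
      congr(($s.condition).hom f)
    have hg (y : M) : s.inl.hom (AddMonoidAlgebra.single (g y) 1) = 1 := by
      have := hc (AddMonoidAlgebra.single y 1)
      simpa using this
    have hk (c : k) : s.inl.hom (AddMonoidAlgebra.single 0 c) = s.inr.hom c := by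
      have := hc (AddMonoidAlgebra.single 0 c)
      simpa using this
    have heq {x x' : N} (hx : h x = h x') :
        s.inl.hom (AddMonoidAlgebra.single x 1) = s.inl.hom (AddMonoidAlgebra.single x' 1) := by
      obtain ⟨y, hy⟩ := (hex (x - x')).mp (by rw [map_sub, hx, sub_self])
      rw [show x = g y + x' by rw [hy, sub_add_cancel], ← one_mul (1 : k),
        ← AddMonoidAlgebra.single_mul_single, map_mul, hg, one_mul, one_mul]
    let χ : Multiplicative L →* s.pt :=
      { toFun := fun x ↦ s.inl.hom (AddMonoidAlgebra.single
          (Function.surjInv hs (Multiplicative.toAdd x)) 1)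
        map_one' := by
          refine (heq (x' := 0) ?_).trans (map_one s.inl.hom)
          rw [Function.surjInv_eq hs, map_zero]; rfl
        map_mul' := fun x y ↦ by
          rw [← map_mul, AddMonoidAlgebra.single_mul_single, one_mul]
          refine heq ?_
          rw [map_add]
          simp only [Function.surjInv_eq hs]; rfl }
    let ψ := AddMonoidAlgebra.liftNCRingHom s.inr.hom χ fun _ _ ↦ mul_comm _ _
    have hψ (x : L) (c : k) : ψ (AddMonoidAlgebra.single x c) =
      s.inr.hom c * χ (Multiplicative.ofAdd x) := AddMonoidAlgebra.liftNCRingHom_single _ _ _ _ _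
    have hψ0 (c : k) : ψ (AddMonoidAlgebra.single 0 c) = s.inr.hom c := by
      rw [hψ, ofAdd_zero, map_one, mul_one]
    have hψ1 (x : L) : ψ (AddMonoidAlgebra.single x 1) = χ (Multiplicative.ofAdd x) := by
      rw [hψ, map_one, one_mul]
    refine ⟨ψ, ?_, ?_⟩
    · refine AddMonoidAlgebra.ringHom_ext (fun c ↦ ?_) (fun x ↦ ?_)
      · simp [hk, hψ0]
      · simp only [RingHom.comp_apply, RingHom.coe_coe,
          AddMonoidAlgebra.mapDomainBialgHom_single, hψ1]
        exact heq (Function.surjInv_eq hs _)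
    · ext c
      simp [hψ0]
  refine ⟨⟨?_⟩, ⟨PushoutCocone.IsColimit.mk _ (fun s ↦ CommRingCat.ofHom (key s).choose)
    (fun s ↦ ?_) (fun s ↦ ?_) (fun s m h1 h2 ↦ ?_)⟩⟩
  · ext1
    refine AddMonoidAlgebra.ringHom_ext (fun c ↦ ?_) (fun x ↦ ?_)
    · simp
    · have : h (g x) = 0 := (hex _).mpr ⟨x, rfl⟩
      simp [this]
  · ext1
    exact (key s).choose_spec.1
  · ext1
    exact (key s).choose_spec.2
  · ext1
    refine (RingHom.cancel_right hsurj).mp ?_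
    exact (congrArg CommRingCat.Hom.hom h1).trans (key s).choose_spec.1.symm

end Duality

end CharacterGroups

/-! ### Kernels of homomorphisms of diagonalizable groups -/

section KernelsOfCharacters

variable {k : Type u} [Field k]

section Kernel

variable {L M N : Type} [AddCommGroup L] [AddCommGroup M] [AddCommGroup N]

/-- An exact sequence `M ⟶ N ⟶ L ⟶ 0` of character groups is dual to a kernel. -/
lemma isKernel_diagMap (g : M →+ N) (h : N →+ L) (hs : Function.Surjective h)
    (hex : ∀ x, h x = 0 ↔ ∃ y, g y = x) : IsKernel (diagMap k h) (diagMap k g) := by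
  have hp : IsPullback (underlying (diagMap k h)).left (toUnit (diagGroup k L).X).left
      (underlying (diagMap k g)).left (η[(diagGroup k M).X] : 𝟙_ _ ⟶ _).left :=
    isPullback_SpecMap_of_isPushout _ _ _ _ (isPushout_of_exact (k := k) g h hs hex)
  have : IsClosedImmersion (underlying (diagMap k h)).left :=
    IsClosedImmersion.spec_of_surjective _ (surjective_mapDomainBialgHom h hs)
  have : Mono (underlying (diagMap k h)) := Over.mono_of_mono_left _
  have hw : underlying (diagMap k h) ≫ underlying (diagMap k g) = 1 := by
    ext1
    refine hp.w.trans ?_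
    rw [← comp_eta (toUnit (diagGroup k L).X)]
    rfl
  refine IsKernel.of_exists_lift hw fun S a ha ↦ ?_
  have ha' : a.left ≫ (underlying (diagMap k g)).left =
      (toUnit S).left ≫ (η[(diagGroup k M).X] : 𝟙_ _ ⟶ _).left := by
    rw [← comp_eta (toUnit S)] at ha
    exact congr(($ha).left)
  refine ⟨Over.homMk (hp.lift a.left (toUnit S).left ha') ?_, ?_⟩
  · rw [← Over.w (underlying (diagMap k h)), hp.lift_fst_assoc, Over.w]
  · ext1
    exact hp.lift_fst _ _ _

lemma isKernel_muInclusion {n : ℕ} (r : Fin n → ℕ) :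
    IsKernel (muInclusion k r) (powerMap k r) := by
  refine isKernel_diagMap _ _ (fun y ↦ ?_) fun x ↦ ?_
  · choose x hx using fun a ↦ ZMod.intCast_surjective (y a)
    exact ⟨x, funext hx⟩
  · constructor
    · intro h
      choose y hy using fun a ↦ (ZMod.intCast_zmod_eq_zero_iff_dvd (x a) (r a)).mp (congrFun h a)
      exact ⟨y, funext fun a ↦ by simp [hy a]⟩
    · rintro ⟨y, rfl⟩
      funext a
      simp

end Kernel

lemma IsKernel.exists_iso {A B H Q : GroupScheme k} {i : A ⟶ H} {j : B ⟶ H} {q : H ⟶ Q}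
    (h1 : IsKernel i q) (h2 : IsKernel j q) : ∃ e : A ≅ B, i = e.hom ≫ j := by
  obtain ⟨f, hf⟩ := h2.exists_lift_hom i h1.comp_eq_one
  obtain ⟨g, hg⟩ := h1.exists_lift_hom j h2.comp_eq_one
  have := h1.mono
  have := h2.mono
  have hi : Mono i := (Grp.forget _).mono_of_mono_map ‹Mono (underlying i)›
  have hj : Mono j := (Grp.forget _).mono_of_mono_map ‹Mono (underlying j)›
  exact ⟨⟨f, g, by rw [← cancel_mono i, Category.assoc, hg, hf, Category.id_comp],
    by rw [← cancel_mono j, Category.assoc, hf, hg, Category.id_comp]⟩, hf.symm⟩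

/-- If `i` is the kernel of `q`, then the kernel of the restriction of `q` along `j` is the
pullback of `i`. -/
lemma IsKernel.pullback {A B H Q : GroupScheme k} {i : A ⟶ H} {j : B ⟶ H} {q : H ⟶ Q}
    (h : IsKernel i q) : IsKernel (pullback.fst j i) (j ≫ q) := by
  have h1 := (IsPullback.of_hasPullback j i).map (Grp.forget _)
  have h2 : IsPullback (underlying (pullback.fst j i)) (underlying (pullback.snd j i) ≫ toUnit A.X)
    (underlying (j ≫ q)) η[Q.X] := h1.paste_vert h
  have e : underlying (pullback.snd j i) ≫ toUnit A.X = toUnit _ := toUnit_unique _ _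
  rwa [e] at h2

lemma IsKernel.comp_iso {A H H' Q Q' : GroupScheme k} {i : A ⟶ H} {q : H ⟶ Q} (h : IsKernel i q)
    (e : H ≅ H') {q' : H' ⟶ Q'} (e' : Q ≅ Q') (w : q ≫ e'.hom = e.hom ≫ q') :
    IsKernel (i ≫ e.hom) q' := by
  refine IsPullback.of_iso h (Iso.refl _) ((Grp.forget _).mapIso e) (Iso.refl _)
    ((Grp.forget _).mapIso e') ?_ ?_ ?_ ?_
  · simp
  · exact toUnit_unique _ _
  · exact congr(($w).hom.hom)
  · simp

end KernelsOfCharacters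

/-! ### The power map on the identity component -/

section PowerMapNormalForm

variable {k : Type u} [Field k]

/-- A surjective homomorphism of diagonalizable groups is injective on characters when its target
is reduced, which `UniqueSums M` ensures. -/
lemma injective_of_surjective_diagMap {M N : Type} [AddCommGroup M] [AddCommGroup N] [UniqueSums M]
    (f : M →+ N) (hf : Surjective (underlying (diagMap k f)).left) : Function.Injective f := by
  have : IsReduced (Spec (.of (AddMonoidAlgebra k M))) :=
    inferInstanceAs (IsReduced (diagGroup k M).X.left)
  have h := injective_of_surjective_specMap (AddMonoidAlgebra.mapDomainBialgHom k f :
    AddMonoidAlgebra k M →+* AddMonoidAlgebra k N) hf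
  intro x y hxy
  exact AddMonoidAlgebra.single_left_injective one_ne_zero
    (h (a₁ := AddMonoidAlgebra.single x 1) (a₂ := AddMonoidAlgebra.single y 1) (by simp [hxy]))

section Extension

variable {n : ℕ} {G Γ T : GroupScheme k} {i : G ⟶ Γ} {π : Γ ⟶ Gm k n} {j : T ⟶ Γ}

/-- Once `T ⟶ Gmⁿ` is a power map, the intersection `T ∩ G` is its kernel, hence the standard
`μ_r`. -/
lemma exists_pullback_iso_mu (hex : IsShortExact i π) {r : Fin n → ℕ} (φ : T ≅ Gm k n)
    (ψ : Gm k n ≅ Gm k n) (h : j ≫ π ≫ ψ.hom = φ.hom ≫ powerMap k r) :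
    ∃ χ : pullback j i ≅ mu k r, pullback.fst j i ≫ φ.hom = χ.hom ≫ muInclusion k r := by
  have h1 : IsKernel (pullback.fst j i) (j ≫ π) :=
    IsKernel.pullback (i := i) (q := π) hex.isKernel
  have h2 := h1.comp_iso φ (q' := powerMap k r) ψ (by simpa using h)
  exact h2.exists_iso (isKernel_muInclusion r)

variable [IsAlgClosed k]

/-- The restriction of `π` to the identity component is, in suitable coordinates, a power map. -/
lemma exists_powerMap (hG : IsFiniteEtale G) [LocallyOfFiniteType Γ.X.hom]
    (hex : IsShortExact i π) (hj : IsIdentityComponent j) :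
    ∃ r : Fin n → ℕ, (∀ a, 0 < r a) ∧ (∀ a b, a ≤ b → r a ∣ r b) ∧
      ∃ (φ : T ≅ Gm k n) (ψ : Gm k n ≅ Gm k n), j ≫ π ≫ ψ.hom = φ.hom ≫ powerMap k r := by
  obtain ⟨X', ⟨e⟩⟩ := exists_identityComponent_iso_diagGroup hG hex hj
  have hs := surjective_identityComponent hG hex hj
  obtain ⟨f, hf⟩ := exists_eq_diagMap (e.inv ≫ j ≫ π)
  have hf' : Function.Injective f := by
    apply injective_of_surjective_diagMap (k := k)
    rw [← hf]
    have : IsIso (underlying e.inv).left :=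
      inferInstanceAs (IsIso ((Grp.forget _ ⋙ Over.forget _).map e.inv))
    exact inferInstanceAs (Surjective ((underlying e.inv).left ≫ (underlying (j ≫ π)).left))
  have : Module.Free ℤ X' := inferInstanceAs (Module.Free ℤ (AddSubgroup.toIntSubmodule X'))
  have : Module.Finite ℤ X' := inferInstanceAs (Module.Finite ℤ (AddSubgroup.toIntSubmodule X'))
  -- `X'` lies in `ℤⁿ`, and `f` embeds `ℤⁿ` into it
  have hrank : Module.finrank ℤ X' = n := by
    apply le_antisymm
    · refine (LinearMap.finrank_le_finrank_of_injective (f := X'.subtype.toIntLinearMap)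
        Subtype.val_injective).trans_eq (by simp)
    · refine Eq.trans_le (by simp) (LinearMap.finrank_le_finrank_of_injective
        (f := f.toIntLinearMap) hf')
  obtain ⟨r, hr, hdvd, u, v, huv⟩ := exists_isDiagonalizedBy_dvd hrank f hf'
  refine ⟨r, hr, hdvd, e ≪≫ diagIso k u.symm, diagIso k v.symm, ?_⟩
  have h1 : j ≫ π = e.hom ≫ diagMap k f := by rw [← hf, e.hom_inv_id_assoc]
  rw [reassoc_of% h1]
  simp only [Iso.trans_hom, Category.assoc, diagIso, powerMap, diagMap_comp]
  congr 2
  refine DFunLike.ext _ _ fun x ↦ u.injective ?_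
  simpa [funext_iff] using huv (v.symm x)

end Extension

lemma eq_of_mu_iso {n : ℕ} {r r' : Fin n → ℕ} (hr : ∀ a, 0 < r a)
    (hdvd : ∀ a b, a ≤ b → r a ∣ r b) (hdvd' : ∀ a b, a ≤ b → r' a ∣ r' b)
    (e : mu k r ≅ mu k r') : r' = r := by
  obtain ⟨e'⟩ := nonempty_addEquiv_of_iso e
  exact eq_of_pi_zmod_addEquiv r r' hr hdvd hdvd' e'.symm

end PowerMapNormalForm

/-! ### Constant group schemes -/

section ConstantGroups

section Constant

variable (k : Type u) [Field k] (Q : Type u)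

/-- The disjoint union of copies of `Spec k` indexed by `Q`. -/
noncomputable def constObj : Over (Spec (.of k)) :=
  Over.mk (Sigma.desc fun _ : Q ↦ 𝟙 (Spec (.of k)))

variable {k Q}

/-- The inclusion of a summand into the constant scheme. -/
noncomputable def constInj (c : Q) : Spec (.of k) ⟶ (constObj k Q).left :=
  Sigma.ι (fun _ : Q ↦ Spec (.of k)) c

instance (c : Q) : IsOpenImmersion (constInj (k := k) c) :=
  inferInstanceAs (IsOpenImmersion (Sigma.ι (fun _ : Q ↦ Spec (.of k)) c))

lemma constInj_hom (c : Q) : constInj (k := k) c ≫ (constObj k Q).hom = 𝟙 _ :=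
  Sigma.ι_desc _ _

lemma exists_constInj (p : (constObj k Q).left) : ∃ c y, constInj (k := k) c y = p := by
  obtain ⟨⟨c, y⟩, rfl⟩ := (sigmaMk (fun _ : Q ↦ Spec (.of k))).surjective p
  exact ⟨c, y, (sigmaMk_mk _ _ _).symm⟩

variable (k Q) in
/-- The locally constant function on the constant scheme recording the index of the summand. -/
noncomputable def constIndex : LocallyConstant (constObj k Q).left Q where
  toFun p := ((sigmaMk (fun _ : Q ↦ Spec (.of k))).symm p).1
  isLocallyConstant := by
    rw [IsLocallyConstant.iff_isOpen_fiber]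
    intro c
    have : IsOpen (Sigma.fst ⁻¹' {c} : Set (Σ _ : Q, Spec (.of k))) := isOpen_sigma_fst_preimage _
    exact this.preimage (sigmaMk (fun _ : Q ↦ Spec (.of k))).symm.continuous

lemma constIndex_constInj (c : Q) (y : Spec (.of k)) : constIndex k Q (constInj c y) = c := by
  change ((sigmaMk (fun _ : Q ↦ Spec (.of k))).symm (Sigma.ι (fun _ : Q ↦ Spec (.of k)) c y)).1 = c
  rw [← sigmaMk_mk, Homeomorph.symm_apply_apply]

/-- The open subscheme on which a locally constant function takes the value `c`. -/
def fiberOpen {X : Scheme.{u}} (ψ : LocallyConstant X Q) (c : Q) : X.Opens :=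
  ⟨ψ ⁻¹' {c}, ψ.isLocallyConstant.isOpen_fiber c⟩

/-- A scheme with a locally constant function is the disjoint union of the fibres. -/
lemma nonempty_isColimit_fiberOpen {X : Scheme.{u}} (ψ : LocallyConstant X Q) :
    Nonempty (IsColimit (Cofan.mk X fun c ↦ (fiberOpen ψ c).ι)) := by
  refine nonempty_isColimit_cofanMk_of _ ?_ ?_
  · rw [eq_top_iff]
    intro x _
    simp only [Scheme.Opens.opensRange_ι, TopologicalSpace.Opens.mem_iSup]
    exact ⟨ψ x, rfl⟩
  · intro c d hcd
    simp only [Function.onFun, Scheme.Opens.opensRange_ι]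
    rw [disjoint_iff, ← TopologicalSpace.Opens.coe_inj]
    ext x
    simp only [TopologicalSpace.Opens.coe_inf, Set.mem_inter_iff]
    constructor
    · rintro ⟨h1, h2⟩
      exact (hcd (h1.symm.trans h2)).elim
    · rintro ⟨⟩

/-- The pullback of the index function along a morphism to the constant scheme. -/
noncomputable def constIndexOf {S : Over (Spec (.of k))} (f : S ⟶ constObj k Q) :
    LocallyConstant S.left Q :=
  (constIndex k Q).comap ⟨f.left, f.left.continuous⟩

lemma ι_fiberOpen_comp {S : Over (Spec (.of k))} (f : S ⟶ constObj k Q) (c : Q) :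
    (fiberOpen (constIndexOf f) c).ι ≫ f.left =
      ((fiberOpen (constIndexOf f) c).ι ≫ S.hom) ≫ constInj c := by
  have h : Set.range ((fiberOpen (constIndexOf f) c).ι ≫ f.left) ⊆
      Set.range (constInj (k := k) c) := by
    rintro _ ⟨⟨x, hx⟩, rfl⟩
    obtain ⟨d, y, hy⟩ := exists_constInj (f.left x)
    have h1 : constIndex k Q (f.left x) = c := hx
    rw [← hy, constIndex_constInj] at h1
    subst h1
    exact ⟨y, hy⟩
  have h1 := IsOpenImmersion.lift_fac (constInj (k := k) c) _ h
  have h2 : IsOpenImmersion.lift (constInj (k := k) c) _ h =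
      (fiberOpen (constIndexOf f) c).ι ≫ S.hom := by
    rw [← Category.comp_id (IsOpenImmersion.lift _ _ _), ← constInj_hom c,
      IsOpenImmersion.lift_fac_assoc, Category.assoc, Over.w]
  rw [← h2, h1]

/-- Morphisms to the constant scheme are the same as locally constant functions. -/
lemma constIndexOf_bijective (S : Over (Spec (.of k))) :
    Function.Bijective (constIndexOf : (S ⟶ constObj k Q) → LocallyConstant S.left Q) := by
  constructor
  · intro f g hfg
    obtain ⟨hc⟩ := nonempty_isColimit_fiberOpen (constIndexOf f)
    ext1
    refine hc.hom_ext fun ⟨c⟩ ↦ ?_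
    change (fiberOpen (constIndexOf f) c).ι ≫ f.left = (fiberOpen (constIndexOf f) c).ι ≫ g.left
    rw [ι_fiberOpen_comp, hfg, ι_fiberOpen_comp]
  · intro ψ
    obtain ⟨hc⟩ := nonempty_isColimit_fiberOpen ψ
    let f : S.left ⟶ (constObj k Q).left :=
      Cofan.IsColimit.desc hc fun c ↦ ((fiberOpen ψ c).ι ≫ S.hom) ≫ constInj c
    have hf (c : Q) : (fiberOpen ψ c).ι ≫ f = ((fiberOpen ψ c).ι ≫ S.hom) ≫ constInj c :=
      Cofan.IsColimit.fac hc _ c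
    refine ⟨Over.homMk f ?_, ?_⟩
    · refine hc.hom_ext fun ⟨c⟩ ↦ ?_
      change (fiberOpen ψ c).ι ≫ f ≫ _ = (fiberOpen ψ c).ι ≫ S.hom
      rw [reassoc_of% (hf c), constInj_hom, Category.comp_id]
    · ext x
      have h1 : f x = constInj (k := k) (ψ x) (S.hom x) :=
        congr($(hf (ψ x)) ⟨x, rfl⟩)
      change constIndex k Q (f x) = ψ x
      rw [h1, constIndex_constInj]

variable [Group Q]

variable (k Q) in
/-- The presheaf of groups `S ↦ {locally constant functions S → Q}`. -/
noncomputable def locallyConstantPresheaf : (Over (Spec (.of k)))ᵒᵖ ⥤ GrpCat.{u} where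
  obj S := .of (LocallyConstant S.unop.left Q)
  map f := GrpCat.ofHom (LocallyConstant.comapMonoidHom ⟨f.unop.left, f.unop.left.continuous⟩)

variable (k Q) in
/-- The constant scheme represents locally constant functions. -/
noncomputable def constRepresentableBy :
    (locallyConstantPresheaf k Q ⋙ forget _).RepresentableBy (constObj k Q) where
  homEquiv := Equiv.ofBijective _ (constIndexOf_bijective _)
  homEquiv_comp _ _ := rfl

noncomputable instance : GrpObj (constObj k Q) :=
  .ofRepresentableBy _ _ (constRepresentableBy k Q)

variable (k Q) in
/-- The constant group scheme attached to an abstract group. -/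
noncomputable def constGroup : GroupScheme k := ⟨constObj k Q⟩

lemma constIndexOf_mul {S : Over (Spec (.of k))} (f g : S ⟶ (constGroup k Q).X) :
    constIndexOf (f * g) = constIndexOf f * constIndexOf g :=
  ((yonedaGrpObjIsoOfRepresentableBy _ (locallyConstantPresheaf k Q)
    (constRepresentableBy k Q)).hom.app (.op S)).hom.map_mul f g

lemma constIndexOf_one {S : Over (Spec (.of k))} :
    constIndexOf (1 : S ⟶ (constGroup k Q).X) = 1 := by
  have := constIndexOf_mul (1 : S ⟶ (constGroup k Q).X) 1
  rwa [mul_one, left_eq_mul] at this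

instance : Etale (constGroup k Q).X.hom :=
  have := HasRingHomProperty.instIsZariskiLocalAtSource
    (P := (@Etale : MorphismProperty Scheme.{u}))
  IsZariskiLocalAtSource.sigmaDesc (P := (@Etale : MorphismProperty Scheme.{u}))
    fun _ ↦ (inferInstance : Etale (𝟙 _))

instance [Finite Q] : CompactSpace (constGroup k Q).X.left :=
  (sigmaMk (fun _ : Q ↦ Spec (.of k))).compactSpace

instance [Finite Q] : QuasiCompact (constGroup k Q).X.hom := inferInstance

end Constant

end ConstantGroups

/-! ### The quotient by the identity component -/

section ComponentGroups

variable {k : Type u} [Field k]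

section ComponentGroup

lemma pt_mem_connectedComponent {X Y : Over (Spec (.of k))} (f : X ⟶ Y) {x : 𝟙_ _ ⟶ X} {p : X.left}
    (h : pt x ∈ connectedComponent p) : pt (x ≫ f) ∈ connectedComponent (f.left p) :=
  f.left.continuous.mapsTo_connectedComponent p h

lemma toUnit_comp_point {X : Over (Spec (.of k))} (z : 𝟙_ _ ⟶ X) {Y : Over (Spec (.of k))}
    (y : 𝟙_ _ ⟶ Y) : z ≫ toUnit X ≫ y = y := by
  rw [← Category.assoc, toUnit_unique (z ≫ toUnit X) (𝟙 _), Category.id_comp]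

lemma constGroup_ext_pts {Q : Type u} [Group Q] {e e' : 𝟙_ _ ⟶ (constGroup k Q).X}
    (h : constIndex k Q (pt e) = constIndex k Q (pt e')) : e = e' := by
  refine (constIndexOf_bijective _).1 (LocallyConstant.ext fun s ↦ ?_)
  change constIndex k Q (e.left s) = constIndex k Q (e'.left s)
  rwa [pt_eq_of_left, pt_eq_of_left]

variable (H : GroupScheme k)

/-- The rational points of the identity component. -/
noncomputable def identitySubgroup : Subgroup (𝟙_ _ ⟶ H.X) where
  carrier := {x | pt x ∈ connectedComponent H.identityPoint}
  one_mem' := by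
    change pt (1 : 𝟙_ _ ⟶ H.X) ∈ connectedComponent H.identityPoint
    rw [pt_one]
    exact mem_connectedComponent
  mul_mem' hx hy := mul_mem_connectedComponent _ _ hx hy
  inv_mem' hx := inv_mem_connectedComponent _ hx

instance : (identitySubgroup H).Normal where
  conj_mem x hx y := by
    let f : H.X ⟶ H.X := (toUnit _ ≫ y) * 𝟙 H.X * (toUnit _ ≫ y⁻¹)
    have hf (z : 𝟙_ _ ⟶ H.X) : z ≫ f = y * z * y⁻¹ := by
      simp only [f, MonObj.comp_mul, toUnit_comp_point, Category.comp_id]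
    have h := pt_mem_connectedComponent f hx
    rw [← pt_one, ← pt_comp, hf, hf, mul_one, mul_inv_cancel, pt_one] at h
    exact h

/-- The group of components of `H`: rational points modulo those in the identity component. Over an
algebraically closed field its elements correspond to the connected components of `H`, as each of
them contains a rational point. -/
abbrev ComponentGroup : Type u := (𝟙_ _ ⟶ H.X) ⧸ identitySubgroup H

variable [IsAlgClosed k] [LocallyOfFiniteType H.X.hom]
  [Finite (_root_.ConnectedComponents H.X.left)]

lemma exists_pt_connectedComponents (C : _root_.ConnectedComponents H.X.left) :
    ∃ x : 𝟙_ _ ⟶ H.X, (pt x : _root_.ConnectedComponents H.X.left) = C := by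
  obtain ⟨p, rfl⟩ := ConnectedComponents.surjective_coe C
  obtain ⟨x, hx⟩ := exists_pt_mem (isOpen_connectedComponent_of_finite p).isLocallyClosed
    ⟨p, mem_connectedComponent⟩
  exact ⟨x, ConnectedComponents.coe_eq_coe'.mpr hx⟩

/-- The locally constant function sending a point to the class of its connected component. -/
lemma exists_componentIndex : ∃ ω : LocallyConstant H.X.left (ComponentGroup H),
    (∀ x : 𝟙_ _ ⟶ H.X, ω (pt x) = x) ∧
      (∀ p, ω p = 1 → p ∈ connectedComponent H.identityPoint) ∧ Finite (ComponentGroup H) := by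
  -- a rational point on each component
  choose x hx using exists_pt_connectedComponents H
  have hval (y : 𝟙_ _ ⟶ H.X) : (x (pt y : _root_.ConnectedComponents H.X.left) :
      ComponentGroup H) = y := by
    refine Eq.symm (QuotientGroup.eq.mpr ?_)
    let f : H.X ⟶ H.X := (toUnit _ ≫ y⁻¹) * 𝟙 H.X
    have hf (z : 𝟙_ _ ⟶ H.X) : z ≫ f = y⁻¹ * z := by
      simp only [f, MonObj.comp_mul, toUnit_comp_point, Category.comp_id]
    have h := pt_mem_connectedComponent f (ConnectedComponents.coe_eq_coe'.mp (hx (pt y)))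
    rw [← pt_comp, hf, hf, inv_mul_cancel, pt_one] at h
    exact h
  refine ⟨⟨fun p ↦ x p, ?_⟩, hval, fun p hp ↦ ?_, ?_⟩
  · exact (IsLocallyConstant.of_discrete
      (fun C : _root_.ConnectedComponents H.X.left ↦ (x C : ComponentGroup H))).comp_continuous
        ConnectedComponents.continuous_coe
  · have h1 : pt (x p) ∈ connectedComponent H.identityPoint :=
      (QuotientGroup.eq_one_iff (N := identitySubgroup H) (x p)).mp hp
    have h2 := ConnectedComponents.coe_eq_coe'.mp (hx p)
    rw [connectedComponent_eq h1, ← connectedComponent_eq h2]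
    exact mem_connectedComponent
  · refine Finite.of_surjective
      (fun C : _root_.ConnectedComponents H.X.left ↦ (x C : ComponentGroup H)) fun y ↦ ?_
    obtain ⟨y, rfl⟩ := QuotientGroup.mk_surjective y
    exact ⟨_, hval y⟩

/-- The homomorphism from a group scheme to its component group, as a constant group scheme: it
sends each rational point to its class, and the fibre over the identity lies in the identity
component. -/
lemma exists_componentGroup_quotient : ∃ q : H ⟶ constGroup k (ComponentGroup H),
    (∀ x : 𝟙_ _ ⟶ H.X, constIndex k _ (pt (x ≫ underlying q)) = x) ∧
      ∀ p, constIndex k _ ((underlying q).left p) = 1 → p ∈ connectedComponent H.identityPoint := by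
  obtain ⟨ω, h1, h2, -⟩ := exists_componentIndex H
  obtain ⟨q, rfl⟩ := (constIndexOf_bijective H.X).2 ω
  let q' : H.X ⟶ (constGroup k (ComponentGroup H)).X := q
  have h1 (x : 𝟙_ _ ⟶ H.X) : constIndex k (ComponentGroup H) (pt (x ≫ q')) = x := h1 x
  have hmul (e e' : 𝟙_ _ ⟶ (constGroup k (ComponentGroup H)).X) :
      constIndex k _ (pt (e * e')) = constIndex k _ (pt e) * constIndex k _ (pt e') :=
    DFunLike.congr_fun (constIndexOf_mul e e') _
  have huniv : (fst H.X H.X * snd H.X H.X) ≫ q' = (fst H.X H.X ≫ q') * (snd H.X H.X ≫ q') := by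
    refine (constIndexOf_bijective _).1 (LocallyConstant.coe_injective ?_)
    let : TopologicalSpace (ComponentGroup H) := ⊥
    have : DiscreteTopology (ComponentGroup H) := ⟨rfl⟩
    have := locallyOfFiniteType_tensor H.X H.X
    refine continuous_ext_pts (LocallyConstant.continuous _) (LocallyConstant.continuous _)
      fun z ↦ ?_
    let idx (e : 𝟙_ _ ⟶ (constGroup k (ComponentGroup H)).X) :=
      constIndex k (ComponentGroup H) (pt e)
    have e1 : z ≫ (fst H.X H.X * snd H.X H.X) ≫ q' =
        ((z ≫ fst H.X H.X) * (z ≫ snd H.X H.X)) ≫ q' := by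
      rw [← Category.assoc, MonObj.comp_mul]
    have e2 : z ≫ ((fst H.X H.X ≫ q') * (snd H.X H.X ≫ q')) =
        ((z ≫ fst H.X H.X) ≫ q') * ((z ≫ snd H.X H.X) ≫ q') := by
      rw [MonObj.comp_mul, Category.assoc, Category.assoc]
    refine (congrArg idx e1).trans (Eq.trans ?_ (congrArg idx e2).symm)
    refine (h1 _).trans (Eq.trans ?_ (hmul _ _).symm)
    exact (congrArg₂ (· * ·) (h1 (z ≫ fst H.X H.X)) (h1 (z ≫ snd H.X H.X))).symm
  have : IsMonHom q' := isMonHom_of_mul q' fun S a b ↦ by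
    have := congr(lift a b ≫ $huniv)
    rwa [← Category.assoc, MonObj.comp_mul, MonObj.comp_mul, lift_fst, lift_snd, lift_fst_assoc,
      lift_snd_assoc] at this
  exact ⟨Grp.homMk q', h1, h2⟩

end ComponentGroup

end ComponentGroups

/-! ### Kernels of pairs of homomorphisms -/

section PairsOfHoms

variable {k : Type u} [Field k]

lemma underlying_injective {A B : GroupScheme k} :
    Function.Injective (underlying : (A ⟶ B) → (A.X ⟶ B.X)) :=
  fun f g h ↦ by ext; exact congr(($h).left)

lemma IsKernel.pullback_snd {A B H Q : GroupScheme k} {i : A ⟶ H} {j : B ⟶ H} {q : H ⟶ Q}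
    (h : IsKernel j q) : IsKernel (pullback.snd j i) (i ≫ q) := by
  have h1 := ((IsPullback.of_hasPullback j i).map (Grp.forget _)).flip
  have h2 : IsPullback (underlying (pullback.snd j i)) (underlying (pullback.fst j i) ≫ toUnit B.X)
    (underlying (i ≫ q)) η[Q.X] := h1.paste_vert h
  have e : underlying (pullback.fst j i) ≫ toUnit B.X = toUnit _ := toUnit_unique _ _
  rwa [e] at h2

/-- The kernel of a pair of homomorphisms is the intersection of the kernels. -/
lemma IsKernel.lift {A B H Q Q' : GroupScheme k} {i : A ⟶ H} {j : B ⟶ H} {q : H ⟶ Q} {p : H ⟶ Q'}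
    (hj : IsKernel j q) (hi : IsKernel i p) : IsKernel (pullback.snd j i ≫ i) (lift q p) := by
  have h1 := (IsPullback.of_hasPullback j i).map (Grp.forget _)
  have h2 := hj.pullback_snd (i := i)
  have := h2.mono
  have := hi.mono
  have : Mono (underlying (pullback.snd j i ≫ i)) :=
    inferInstanceAs (Mono (underlying (pullback.snd j i) ≫ underlying i))
  have hl : underlying (CartesianMonoidalCategory.lift q p) =
    CartesianMonoidalCategory.lift (underlying q) (underlying p) := rfl
  have e1 : underlying (pullback.snd j i ≫ i) = underlying (pullback.snd j i) ≫ underlying i := rfl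
  have e2 : underlying (i ≫ q) = underlying i ≫ underlying q := rfl
  refine IsKernel.of_exists_lift ?_ fun S a ha ↦ ?_
  · rw [hl, comp_lift, e1]
    apply CartesianMonoidalCategory.hom_ext
    · rw [lift_fst, Category.assoc, ← e2, h2.comp_eq_one]
      exact (MonObj.one_comp (underlying (fst Q Q'))).symm
    · rw [lift_snd, Category.assoc, hi.comp_eq_one, MonObj.comp_one]
      exact (MonObj.one_comp (underlying (snd Q Q'))).symm
  · rw [hl, comp_lift] at ha
    have ha1 : a ≫ underlying q = 1 := by
      have := congrArg (fun f : S ⟶ (Q ⊗ Q').X ↦ f ≫ underlying (fst Q Q')) ha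
      exact (lift_fst _ _).symm.trans (this.trans (MonObj.one_comp (underlying (fst Q Q'))))
    have ha2 : a ≫ underlying p = 1 := by
      have := congrArg (fun f : S ⟶ (Q ⊗ Q').X ↦ f ≫ underlying (snd Q Q')) ha
      exact (lift_snd _ _).symm.trans (this.trans (MonObj.one_comp (underlying (snd Q Q'))))
    obtain ⟨g, hg⟩ := hi.exists_lift a ha2
    obtain ⟨g', hg'⟩ := h2.exists_lift g (by rw [e2, ← Category.assoc, hg, ha1])
    exact ⟨g', by rw [e1, ← Category.assoc, hg', hg]⟩

instance {A B : GroupScheme k} : IsMonHom (1 : A.X ⟶ B.X) :=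
  isMonHom_of_mul (A := A) (B := B) _ fun S a b ↦ by simp

/-- The trivial homomorphism. -/
noncomputable def trivialHom (A B : GroupScheme k) : A ⟶ B := Grp.homMk 1

lemma comp_trivialHom {A B H : GroupScheme k} (f : A ⟶ B) :
    f ≫ trivialHom B H = trivialHom A H :=
  underlying_injective (MonObj.comp_one (underlying f))

lemma IsKernel.comp_eq_trivialHom {N H Q : GroupScheme k} {i : N ⟶ H} {q : H ⟶ Q}
    (h : IsKernel i q) : i ≫ q = trivialHom N Q :=
  underlying_injective h.comp_eq_one

lemma isKernel_lift_trivialHom (A B : GroupScheme k) :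
    IsKernel (lift (𝟙 A) (trivialHom A B)) (snd A B) := by
  have hl : underlying (lift (𝟙 A) (trivialHom A B)) = lift (𝟙 A.X) (1 : A.X ⟶ B.X) := rfl
  have hs : underlying (snd A B) = snd A.X B.X := rfl
  have : Mono (underlying (lift (𝟙 A) (trivialHom A B))) :=
    ⟨fun a b hab ↦ by
      have h := congrArg (fun f : _ ⟶ A.X ⊗ B.X ↦ f ≫ fst A.X B.X) hab
      simp only [hl, Category.assoc, lift_fst, Category.comp_id] at h
      exact h⟩
  refine IsKernel.of_exists_lift (by rw [hl, hs, lift_snd]) fun S a ha ↦ ⟨a ≫ fst A.X B.X, ?_⟩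
  rw [hs] at ha
  rw [hl, comp_lift, Category.comp_id, MonObj.comp_one, ← ha]
  apply CartesianMonoidalCategory.hom_ext
  · rw [lift_fst]
  · rw [lift_snd]

/-- An étale morphism is open, so it is surjective once all rational points lift. -/
lemma surjective_of_exists_pt [IsAlgClosed k] {X Y : Over (Spec (.of k))}
    [LocallyOfFiniteType X.hom] [LocallyOfFiniteType Y.hom] (f : X ⟶ Y) [Etale f.left]
    (h : ∀ y : 𝟙_ _ ⟶ Y, ∃ x, x ≫ f = y) : Surjective f.left := by
  refine ⟨Set.range_eq_univ.mp (eq_univ_of_isOpen f.left.isOpenMap.isOpen_range fun y ↦ ?_)⟩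
  obtain ⟨x, rfl⟩ := h y
  exact ⟨pt x, rfl⟩

section Extension

variable {n : ℕ} {G Γ T : GroupScheme k} {i : G ⟶ Γ} {π : Γ ⟶ Gm k n} {j : T ⟶ Γ}

lemma isKernel_identityComponent [IsAlgClosed k] [LocallyOfFiniteType Γ.X.hom]
    (hj : IsIdentityComponent j) {q : Γ ⟶ constGroup k (ComponentGroup Γ)}
    (h1 : ∀ x : 𝟙_ _ ⟶ Γ.X, constIndex k _ (pt (x ≫ underlying q)) = x)
    (h2 : ∀ p, constIndex k _ ((underlying q).left p) = 1 →
      p ∈ connectedComponent Γ.identityPoint) : IsKernel j q := by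
  have := hj.isOpenImmersion
  have hT : LocallyOfFiniteType T.X.hom := by rw [← Over.w (underlying j)]; infer_instance
  have : Mono (underlying j) := Over.mono_of_mono_left _
  refine IsKernel.of_exists_lift ?_ fun S a ha ↦ ?_
  · refine (constIndexOf_bijective _).1 (LocallyConstant.coe_injective ?_)
    rw [constIndexOf_one]
    let : TopologicalSpace (ComponentGroup Γ) := ⊥
    have : DiscreteTopology (ComponentGroup Γ) := ⟨rfl⟩
    refine continuous_ext_pts (LocallyConstant.continuous _) (LocallyConstant.continuous _)
      fun x ↦ ?_
    refine (h1 (x ≫ underlying j)).trans ((QuotientGroup.eq_one_iff _).mpr ?_)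
    change pt (x ≫ underlying j) ∈ connectedComponent Γ.identityPoint
    rw [← hj.range_eq]
    exact ⟨pt x, rfl⟩
  · have h3 : Set.range a.left ⊆ Set.range (underlying j).left := by
      rw [hj.range_eq]
      rintro _ ⟨s, rfl⟩
      refine h2 _ ?_
      have := DFunLike.congr_fun (congrArg constIndexOf ha) s
      rw [constIndexOf_one] at this
      exact this
    refine ⟨Over.homMk (IsOpenImmersion.lift (underlying j).left a.left h3) ?_, ?_⟩
    · rw [← Over.w (underlying j), IsOpenImmersion.lift_fac_assoc, Over.w]
    · ext1
      exact IsOpenImmersion.lift_fac _ _ _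

end Extension

end PairsOfHoms

/-! ### The quotients by the intersection of the identity component with `G` -/

section QuotientSequences

variable {k : Type u} [Field k]

section Quotient

variable {E Q : GroupScheme k}

/-- The structure morphism of a group scheme is split by the unit section. -/
instance surjective_hom : Surjective Q.X.hom := by
  have h : η[Q.X].left ≫ Q.X.hom = 𝟙 _ := Over.w η[Q.X]
  have : Surjective (η[Q.X].left ≫ Q.X.hom) := by rw [h]; infer_instance
  exact Surjective.of_comp η[Q.X].left Q.X.hom

lemma flat_fst : Flat (underlying (fst E Q)).left :=
  inferInstanceAs (Flat (pullback.fst E.X.hom Q.X.hom))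

lemma surjective_fst : Surjective (underlying (fst E Q)).left :=
  inferInstanceAs (Surjective (pullback.fst E.X.hom Q.X.hom))

lemma etale_snd [Etale E.X.hom] : Etale (underlying (snd E Q)).left :=
  inferInstanceAs (Etale (pullback.snd E.X.hom Q.X.hom))

/-- The split exact sequence `1 ⟶ E ⟶ E × Q ⟶ Q ⟶ 1`. -/
lemma isShortExact_lift_trivialHom [Etale E.X.hom] [QuasiCompact E.X.hom] :
    IsShortExact (lift (𝟙 E) (trivialHom E Q)) (snd E Q) where
  isKernel := isKernel_lift_trivialHom E Q
  flat := have := etale_snd (E := E) (Q := Q); inferInstance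
  surjective := inferInstanceAs (Surjective (pullback.snd E.X.hom Q.X.hom))
  quasiCompact := inferInstanceAs (QuasiCompact (pullback.snd E.X.hom Q.X.hom))

lemma etale_underlying [Etale E.X.hom] [Etale Q.X.hom] (f : E ⟶ Q) : Etale (underlying f).left :=
  MorphismProperty.of_postcomp (W := (@Etale : MorphismProperty Scheme.{u})) (W' := @Etale) _
    Q.X.hom inferInstance (by rw [Over.w]; infer_instance)

lemma quasiCompact_underlying [QuasiCompact E.X.hom] [IsSeparated Q.X.hom] (f : E ⟶ Q) :
    QuasiCompact (underlying f).left :=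
  have : QuasiCompact ((underlying f).left ≫ Q.X.hom) := by rw [Over.w]; infer_instance
  QuasiCompact.of_comp _ Q.X.hom

/-- The second projection `E × Q ⟶ Q` and the composite `H ⟶ E × Q ⟶ Q` are étale, hence so is the
first factor. -/
lemma etale_lift [Etale E.X.hom] {H : GroupScheme k} (q : H ⟶ E) (p : H ⟶ Q)
    [Etale (underlying p).left] : Etale (underlying (lift q p)).left := by
  have := etale_snd (E := E) (Q := Q)
  have h : (underlying (lift q p)).left ≫ (underlying (snd E Q)).left = (underlying p).left := by
    have : underlying (lift q p) ≫ underlying (snd E Q) = underlying p := lift_snd _ _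
    exact congr(($this).left)
  exact MorphismProperty.of_postcomp (W := (@Etale : MorphismProperty Scheme.{u})) (W' := @Etale) _
    _ this (by rwa [h])

end Quotient

section Extension

variable [IsAlgClosed k] {n : ℕ} {G Γ T : GroupScheme k} {i : G ⟶ Γ} {π : Γ ⟶ Gm k n} {j : T ⟶ Γ}

/-- With `E` the component group of `Γ` and `q : Γ ⟶ E` the canonical homomorphism:
`E = Γ / T`, `E = G / (T ∩ G)` and `E × Gmⁿ = Γ / (T ∩ G)`, the last via `(q, π)`. -/
lemma exists_quotients (hG : IsFiniteEtale G) (hΓ : IsAlgebraic Γ) (hex : IsShortExact i π)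
    (hj : IsIdentityComponent j) :
    ∃ (E : GroupScheme k) (q : Γ ⟶ E), IsShortExact j q ∧
      IsShortExact (pullback.snd j i) (i ≫ q) ∧
      IsShortExact (pullback.snd j i ≫ i) (lift q π) ∧
      IsShortExact (lift (𝟙 E) (trivialHom E (Gm k n))) (snd E (Gm k n)) := by
  have := hΓ.locallyOfFiniteType
  have := hΓ.quasiCompact
  have := finite_connectedComponents hG hex
  have hπ := hex.etale hG.etale
  have hGe := hG.etale
  have hGf := hG.finite
  obtain ⟨-, -, -, hfin⟩ := exists_componentIndex Γ
  obtain ⟨q, hq1, hq2⟩ := exists_componentGroup_quotient Γ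
  have hT : LocallyOfFiniteType T.X.hom := by
    have := hj.isOpenImmersion
    rw [← Over.w (underlying j)]
    infer_instance
  have hk := isKernel_identityComponent hj hq1 hq2
  -- rational points of the quotient lift to `Γ`
  have hq3 (e : 𝟙_ _ ⟶ (constGroup k (ComponentGroup Γ)).X) :
      ∃ x : 𝟙_ _ ⟶ Γ.X, x ≫ underlying q = e := by
    obtain ⟨x, hx⟩ := QuotientGroup.mk_surjective (constIndex k (ComponentGroup Γ) (pt e))
    exact ⟨x, constGroup_ext_pts ((hq1 x).trans hx)⟩
  -- rational points of the torus lift to `T`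
  have hj3 (y : 𝟙_ _ ⟶ (Gm k n).X) : ∃ t : 𝟙_ _ ⟶ T.X, (t ≫ underlying j) ≫ underlying π = y := by
    have hs := surjective_identityComponent hG hex hj
    obtain ⟨t, ht⟩ := exists_pt_lift (underlying (j ≫ π)) (y := y) (hs.surj _)
    exact ⟨t, (Category.assoc _ _ _).trans ht⟩
  have hjq (t : 𝟙_ _ ⟶ T.X) : (t ≫ underlying j) ≫ underlying q = 1 := by
    rw [Category.assoc, hk.comp_eq_one, MonObj.comp_one]
  have hE : LocallyOfFiniteType (constGroup k (ComponentGroup Γ) ⊗ Gm k n).X.hom :=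
    locallyOfFiniteType_tensor _ _
  have he1 := etale_lift q π
  have he2 := etale_underlying (i ≫ q)
  have hs1 : Surjective (underlying (lift q π)).left := by
    refine surjective_of_exists_pt _ fun y ↦ ?_
    obtain ⟨x, hx⟩ := hq3 (y ≫ underlying (fst _ _))
    -- correct `x` by a point of `T`, which does not change its image under `q`
    obtain ⟨t, ht⟩ := hj3 ((x ≫ underlying π)⁻¹ * (y ≫ underlying (snd _ _)))
    refine ⟨x * (t ≫ underlying j), ?_⟩
    have hl : underlying (lift q π) = lift (underlying q) (underlying π) := rfl
    rw [hl, comp_lift, MonObj.mul_comp, MonObj.mul_comp, ht, hjq, mul_one, hx, mul_inv_cancel_left]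
    apply CartesianMonoidalCategory.hom_ext
    · exact lift_fst _ _
    · exact lift_snd _ _
  have hq1 : (underlying (lift q π)).left ≫ (underlying (fst _ (Gm k n))).left =
      (underlying q).left := by
    have : underlying (lift q π) ≫ underlying (fst _ (Gm k n)) = underlying q := lift_fst _ _
    exact congr(($this).left)
  refine ⟨_, q, ⟨hk, ?_, ?_, ?_⟩, ⟨hk.pullback_snd, ?_, ?_, ?_⟩,
    ⟨hk.lift hex.isKernel, inferInstance, hs1, ?_⟩, isShortExact_lift_trivialHom⟩
  · rw [← hq1]
    have := flat_fst (E := constGroup k (ComponentGroup Γ)) (Q := Gm k n)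
    infer_instance
  · rw [← hq1]
    have := surjective_fst (E := constGroup k (ComponentGroup Γ)) (Q := Gm k n)
    infer_instance
  · exact quasiCompact_underlying q
  · infer_instance
  · refine surjective_of_exists_pt _ fun e ↦ ?_
    obtain ⟨x, rfl⟩ := hq3 e
    obtain ⟨t, ht⟩ := hj3 (x ≫ underlying π)
    -- `x` differs by a point of `T` from a point of the kernel `G` of `π`
    obtain ⟨g, hg⟩ := IsKernel.exists_lift (i := i) (q := π) hex.isKernel
      (x * (t ≫ underlying j)⁻¹) (by rw [MonObj.mul_comp, GrpObj.inv_comp, ht, mul_inv_cancel])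
    refine ⟨g, ?_⟩
    have e2 : underlying (i ≫ q) = underlying i ≫ underlying q := rfl
    rw [e2, ← Category.assoc, hg, MonObj.mul_comp, GrpObj.inv_comp, hjq, inv_one, mul_one]
  · exact quasiCompact_underlying _
  · exact quasiCompact_underlying _

end Extension

end QuotientSequences

end GroupScheme

open GroupScheme in
theorem mainTheorem10 {k : Type u} [Field k] [IsAlgClosed k] (n : ℕ)
    (G Γ : GroupScheme k) (hG : IsFiniteEtale G) (hΓ : IsAlgebraic Γ)
    (i : G ⟶ Γ) (π : Γ ⟶ Gm k n) (hex : IsShortExact i π) :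
    -- the identity component `j : T ⟶ Γ`
    ∃ (T : GroupScheme k) (j : T ⟶ Γ), IsIdentityComponent j ∧
      -- `T` is an `n`-torus, `T ⟶ Gmⁿ` is a power map in suitable bases, `T ∩ G = μ_r`
      (∃ r : Fin n → ℕ, (∀ a, 0 < r a) ∧ (∀ a b, a ≤ b → r a ∣ r b) ∧
        (∃ (φ : T ≅ Gm k n) (ψ : Gm k n ≅ Gm k n) (χ : pullback j i ≅ mu k r),
          j ≫ π ≫ ψ.hom = φ.hom ≫ powerMap k r ∧
          pullback.fst j i ≫ φ.hom = χ.hom ≫ muInclusion k r) ∧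
        -- uniqueness of `r`
        (∀ r' : Fin n → ℕ, (∀ a b, a ≤ b → r' a ∣ r' b) →
          Nonempty (pullback j i ≅ mu k r') → r' = r)) ∧
      -- `T` is central in `Γ`
      IsCentral j ∧
      -- the quotients `Gbar = G / μ_r` and `Γbar = Γ / μ_r`, with `μ_r = T ∩ G`
      ∃ (Gbar Γbar : GroupScheme k) (qG : G ⟶ Gbar) (qΓ : Γ ⟶ Γbar),
        IsShortExact (pullback.snd j i) qG ∧ IsShortExact (pullback.snd j i ≫ i) qΓ ∧
        -- the induced exact sequence `1 ⟶ Gbar ⟶ Γbar ⟶ Gmⁿ ⟶ 1`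
        ∃ (ibar : Gbar ⟶ Γbar) (πbar : Γbar ⟶ Gm k n),
          qG ≫ ibar = i ≫ qΓ ∧ qΓ ≫ πbar = π ∧ IsShortExact ibar πbar ∧
          -- is trivially split, `Γbar ≅ Gbar × Gmⁿ`
          ∃ e : Γbar ≅ Gbar ⊗ Gm k n,
            ibar ≫ e.hom ≫ fst Gbar (Gm k n) = 𝟙 Gbar ∧
            e.hom ≫ snd Gbar (Gm k n) = πbar ∧
            -- and `Γ ⟶ Γbar ⟶ Gbar` is the quotient of `Γ` by `T`, so `Γ / T ≅ G / μ_r`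
            IsShortExact j (qΓ ≫ e.hom ≫ fst Gbar (Gm k n)) := by
  have := hΓ.locallyOfFiniteType
  have := finite_connectedComponents hG hex
  obtain ⟨T, j, hj⟩ := exists_identityComponent Γ
  refine ⟨T, j, hj, ?_, isCentral_identityComponent hG hex hj, ?_⟩
  · obtain ⟨r, hr, hdvd, φ, ψ, h⟩ := exists_powerMap hG hex hj
    obtain ⟨χ, hχ⟩ := exists_pullback_iso_mu hex φ ψ h
    exact ⟨r, hr, hdvd, ⟨φ, ψ, χ, h, hχ⟩,
      fun r' hdvd' ⟨e⟩ ↦ eq_of_mu_iso hr hdvd hdvd' (χ.symm ≪≫ e)⟩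
  · obtain ⟨E, q, hq, hG', hΓ', hE⟩ := exists_quotients hG hΓ hex hj
    have hi : i ≫ π = trivialHom G (Gm k n) := IsKernel.comp_eq_trivialHom (i := i) hex.isKernel
    refine ⟨E, E ⊗ Gm k n, i ≫ q, lift q π, hG', hΓ', lift (𝟙 E) (trivialHom E _), snd _ _,
      ?_, lift_snd _ _, hE, Iso.refl _, ?_, ?_, ?_⟩
    · rw [comp_lift, comp_lift, Category.comp_id, comp_trivialHom, hi]
    · rw [Iso.refl_hom, Category.id_comp, lift_fst]
    · rw [Iso.refl_hom, Category.id_comp]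
    · rwa [Iso.refl_hom, Category.id_comp, lift_fst]
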